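/- Let $(\Omega,P)$ be a probability space with a measure-preserving ergodic action $(\tau_x)_{x\in\mathbb R^3}$ of $\mathbb R^3$ by measurable maps, $\tau_x\tau_y=\tau_{x+y}$, such that the unitary operators $(T_xf)(\omega)=f(\tau_{-x}\omega)$ on $\mathscr H_0=L^2(\Omega,P;\mathbb C)$ are strongly continuous in $x$. Let $L_i$ ($i=1,2,3$) be the generators, $L_if=\partial_{x_i}(T_xf)|_{x=0}$ (derivative in $\mathscr H_0$), with domain $\mathscr D_i$ the set of all $f$ for which the derivative exists. Let $\mathscr H=\mathscr H_0^3$ with its $L^2$ inner product and let $$\mathscr H^1=\{\xi\in\mathscr H:\ \xi_k\in\mathscr D_1\cap\mathscr D_2\cap\mathscr D_3,\ \langle\xi_k\rangle=0\ \text{for all }k\},$$ $$\mathscr H^2=\{\xi\in\mathscr H^1:\ L_j\xi_k\in\mathscr D_i\ \text{for all } i,j,k\},$$ where $\langle\cdot\rangle$ is the mean. Let $\overline{\mathscr H^1}$ be the completion of $\mathscr H^1$ in the $L^2$ inner product, i.e. its closure in $\mathscr H$. On $\mathscr H^1$ define $$\nabla\times\xi=(L_2\xi_3-L_3\xi_2,\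 L_3\xi_1-L_1\xi_3,\ L_1\xi_2-L_2\xi_1),\qquad \nabla^*\xi=-\sum_iL_i\xi_i .$$ Let $\mathcal R(\nabla\times)$ be the range of $\nabla\times:\mathscr H^1\to\mathscr H$. Let $\nabla\times\nabla\times$ be taken on the domain $\{\eta\in\mathscr H^2:\nabla^*\eta=0\}$. Let $R(\omega)$ be a measurable field of rotation matrices in $SO(3)$, and let $X_1$ be the operator of multiplication by $R^TCR$ on $\mathscr H$, where $C=\mathrm{diag}(1,0,0)$. Then: 1. In $\overline{\mathscr H^1}$ the adjoint of $\nabla\times$ is the closure of $\nabla\times$. 2. $\nabla\times\nabla\times$ (on the stated domain, all of which is in its natural domain) is one-to-one. The composite $\Upsilon_0=\nabla\times(\nabla\times\nabla\times)^{-1}\nabla\times$, with its natural domain $\{\xi\in\mathscr H^1:\nabla\times\xi\in\mathcal R(\nabla\times\nabla\times)\}$, is densely defined in $\overline{\mathscr H^1}$, and its range is $\mathcal R(\nabla\times)\cap\mathscr H^1$. If $\mathcal R(\nabla\times)$ is closed, then its domain is all of $\mathscr H^1$. 3. $\Upsilon_0$ has a (necessarily unique) bounded extension $\Upsilon:\overline{\mathscr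 H^1}\to\overline{\mathscr H^1}$. It is the orthogonal projection onto $\overline{\mathcal R(\nabla\times)}$, it maps $\mathscr H^1$ into $\mathscr H^1$ (hence into $\overline{\mathcal R(\nabla\times)}\cap\mathscr H^1$), and it is self-adjoint. 4. If $X_1$ maps $\mathscr H^1$ into $\mathscr H^1$, then $X_1$ restricts to a bounded operator on $\overline{\mathscr H^1}$, $X_1\Upsilon X_1$ maps $\mathscr H^1$ into $\mathscr H^1$ and is self-adjoint on $\overline{\mathscr H^1}$, and its spectrum is contained in $[0,1]$. 5. Without any condition on $X_1$: if $\Upsilon$ is extended to $\mathscr H$ by zero on the orthogonal complement of $\overline{\mathscr H^1}$ (the constant fields), then $X_1\Upsilon X_1$ is self-adjoint on $\mathscr H$ and its spectrum is contained in $[0,1]$. -/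

import Mathlib

open MeasureTheory
open scoped ENNReal InnerProductSpace

noncomputable section

/-- The composition `g ∘ f` of two partially defined linear maps, with its natural domain
`{x ∈ D(f) : f x ∈ D(g)}`. -/
def LinearPMap.naturalComp {E F G : Type*} [AddCommGroup E] [Module ℂ E] [AddCommGroup F]
    [Module ℂ F] [AddCommGroup G] [Module ℂ G] (g : F →ₗ.[ℂ] G) (f : E →ₗ.[ℂ] F) :
    E →ₗ.[ℂ] G :=
  g.comp (f.domRestrict ((g.domain.comap f.toFun).map f.domain.subtype)) (by
    rintro ⟨x, hx⟩
    obtain ⟨y, hy, hyx⟩ := hx.1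
    have h : f.domRestrict ((g.domain.comap f.toFun).map f.domain.subtype) ⟨x, hx⟩ = f y :=
      LinearPMap.domRestrict_apply hyx.symm
    rw [h]
    exact hy)

namespace StationaryField

/-- The Hilbert space of complex-valued square-integrable random variables. -/
abbrev ScalarL2 {Ω : Type*} [MeasurableSpace Ω] (P : Measure Ω) : Type _ := Lp ℂ 2 P

/-- The Hilbert space of square-integrable random fields with values in `ℂ³`. -/
abbrev VectorL2 {Ω : Type*} [MeasurableSpace Ω] (P : Measure Ω) : Type _ :=
  PiLp 2 (fun _ : Fin 3 => ScalarL2 P)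

section Operators

variable {Ω : Type*} [MeasurableSpace Ω] (P : Measure Ω) [IsProbabilityMeasure P]
  [AddAction (Fin 3 → ℝ) Ω] [MeasurableConstVAdd (Fin 3 → ℝ) Ω]
  [VAddInvariantMeasure (Fin 3 → ℝ) Ω P]

/-- The translation operator `(T_x f)(ω) = f(τ_{-x} ω)`; here `τ_x ω` is written `x +ᵥ ω`. -/
def translation (x : Fin 3 → ℝ) : ScalarL2 P →ₗᵢ[ℂ] ScalarL2 P :=
  Lp.compMeasurePreservingₗᵢ ℂ (fun ω : Ω => (-x) +ᵥ ω) (measurePreserving_vadd (-x) P)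

/-- The `i`-th infinitesimal generator: `L_i f = ∂/∂x_i (T_x f)` at `x = 0`, the derivative being
taken in `L²`, with domain the set of all `f` for which it exists. -/
def generator (i : Fin 3) : ScalarL2 P →ₗ.[ℂ] ScalarL2 P where
  domain :=
    { carrier := {f | DifferentiableAt ℝ (fun t : ℝ => translation P (Pi.single i t) f) 0}
      add_mem' := by
        intro f g hf hg
        simp only [Set.mem_ofPred_eq, map_add] at *
        exact hf.add hg
      zero_mem' := by simp
      smul_mem' := by
        intro c f hf
        simp only [Set.mem_ofPred_eq, map_smul] at *
        exact hf.const_smul c }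
  toFun :=
    { toFun := fun f => deriv (fun t : ℝ => translation P (Pi.single i t) (f : ScalarL2 P)) 0
      map_add' := by
        intro f g
        simp only [Submodule.coe_add, map_add]
        exact deriv_fun_add f.2 g.2
      map_smul' := by
        intro c f
        simp only [Submodule.coe_smul, map_smul, RingHom.id_apply]
        exact deriv_fun_const_smul c f.2 }

/-- Scalar fields of mean zero in the intersection of the domains of `L_1, L_2, L_3`. -/
def H1Scalar : Submodule ℂ (ScalarL2 P) where
  carrier := {f | (∀ i, f ∈ (generator P i).domain) ∧ ∫ ω, f ω ∂P = 0}
  add_mem' := by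
    rintro f g ⟨hf, hf0⟩ ⟨hg, hg0⟩
    refine ⟨fun i => add_mem (hf i) (hg i), ?_⟩
    rw [integral_congr_ae (Lp.coeFn_add f g)]
    simp only [Pi.add_apply]
    rw [integral_add ((Lp.memLp f).integrable (by norm_num))
      ((Lp.memLp g).integrable (by norm_num)), hf0, hg0, add_zero]
  zero_mem' := by
    refine ⟨fun i => zero_mem _, ?_⟩
    rw [integral_congr_ae (Lp.coeFn_zero ℂ 2 P)]
    simp
  smul_mem' := by
    rintro c f ⟨hf, hf0⟩
    refine ⟨fun i => Submodule.smul_mem _ c (hf i), ?_⟩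
    rw [integral_congr_ae (Lp.coeFn_smul c f)]
    simp only [Pi.smul_apply]
    rw [integral_smul, hf0, smul_zero]

/-- Scalar fields of mean zero such that all `L_i f` and all `L_i (L_j f)` exist in `L²`. -/
def H2Scalar : Submodule ℂ (ScalarL2 P) :=
  H1Scalar P ⊓ ⨅ i, ⨅ j, ((generator P i).naturalComp (generator P j)).domain

/-- The vector fields whose three components belong to a given space of scalar fields. -/
def componentwise (S : Submodule ℂ (ScalarL2 P)) : Submodule ℂ (VectorL2 P) where
  carrier := {ξ | ∀ k, ξ k ∈ S}
  add_mem' := fun hξ hζ k => add_mem (hξ k) (hζ k)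
  zero_mem' := fun _ => zero_mem S
  smul_mem' := fun c _ hξ k => Submodule.smul_mem S c (hξ k)

/-- The space `H¹` of vector fields (before completion). -/
def H1 : Submodule ℂ (VectorL2 P) := componentwise P (H1Scalar P)

/-- The space `H²` of vector fields (before completion). -/
def H2 : Submodule ℂ (VectorL2 P) := componentwise P (H2Scalar P)

/-- The Hilbert space obtained by completing `H¹` with respect to the `L²` inner product,
realized as the closure of `H¹` in the space of square-integrable fields. -/
abbrev H1Hilbert : Submodule ℂ (VectorL2 P) := (H1 P).topologicalClosure

/-- `L_i` applied to the `k`-th component of a field in `H¹`. -/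
def partialDeriv (i k : Fin 3) : H1 P →ₗ[ℂ] ScalarL2 P where
  toFun := fun ξ => generator P i ⟨(ξ : VectorL2 P) k, (ξ.2 k).1 i⟩
  map_add' := fun ξ ζ => (generator P i).map_add
    ⟨(ξ : VectorL2 P) k, (ξ.2 k).1 i⟩ ⟨(ζ : VectorL2 P) k, (ζ.2 k).1 i⟩
  map_smul' := fun c ξ => (generator P i).map_smul c ⟨(ξ : VectorL2 P) k, (ξ.2 k).1 i⟩

/-- The generalized curl, with domain `H¹`. -/
def curl : VectorL2 P →ₗ.[ℂ] VectorL2 P where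
  domain := H1 P
  toFun := (WithLp.linearEquiv 2 ℂ (Fin 3 → ScalarL2 P)).symm.toLinearMap ∘ₗ LinearMap.pi
    ![partialDeriv P 1 2 - partialDeriv P 2 1,
      partialDeriv P 2 0 - partialDeriv P 0 2,
      partialDeriv P 0 1 - partialDeriv P 1 0]

/-- The adjoint `∇* ζ = -∑ L_i ζ_i` of the generalized gradient, with domain `H¹`. -/
def gradAdjoint : VectorL2 P →ₗ.[ℂ] ScalarL2 P where
  domain := H1 P
  toFun := -∑ i, partialDeriv P i i

/-- The range of the generalized curl. -/
def curlRange : Submodule ℂ (VectorL2 P) := LinearMap.range (curl P).toFun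

/-- The kernel of `∇*`. -/
def gradAdjointKernel : Submodule ℂ (VectorL2 P) :=
  (LinearMap.ker (gradAdjoint P).toFun).map (gradAdjoint P).domain.subtype

/-- The operator `∇×∇×` on the fields in `H²` that lie in the kernel of `∇*`. -/
def curlCurl : VectorL2 P →ₗ.[ℂ] VectorL2 P :=
  ((curl P).naturalComp (curl P)).domRestrict (H2 P ⊓ gradAdjointKernel P)

/-- The composite `∇×(∇×∇×)⁻¹∇×` with its natural domain
`{ξ ∈ H¹ : ∇×ξ ∈ R(∇×∇×)}`. -/
def upsilonComposite : VectorL2 P →ₗ.[ℂ] VectorL2 P :=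
  (curl P).naturalComp ((curlCurl P).inverse.naturalComp (curl P))

/-- The extension by zero, to all square-integrable fields, of an operator on the completed
space `H¹`. -/
def extendByZero (A : H1Hilbert P →L[ℂ] H1Hilbert P) : VectorL2 P →L[ℂ] VectorL2 P :=
  (H1Hilbert P).subtypeL ∘L A ∘L (H1Hilbert P).orthogonalProjectionOnto

end Operators

section Crystal

variable {Ω : Type*} [MeasurableSpace Ω]

/-- The matrix `X₁ = Rᵀ C R`, `C = diag(1, 0, 0)`. -/
def crystalProjection (R : Matrix (Fin 3) (Fin 3) ℝ) : Matrix (Fin 3) (Fin 3) ℝ :=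
  R.transpose * Matrix.diagonal (Pi.single 0 1) * R

/-- Multiplication of scalar fields by the class of an essentially bounded function. -/
def mulOperator (P : Measure Ω) [IsProbabilityMeasure P] (m : Lp ℂ ∞ P) :
    ScalarL2 P →L[ℂ] ScalarL2 P :=
  (ContinuousLinearMap.mul ℂ ℂ).holderL P ∞ 2 2 m

/-- The entries of a measurable field of matrices `RᵀCR` with `R` orthogonal are bounded by 1. -/
theorem crystalProjection_memLp (P : Measure Ω) [IsProbabilityMeasure P]
    (R : Ω → Matrix.specialOrthogonalGroup (Fin 3) ℝ)
    (hR : ∀ j k, Measurable fun ω => (R ω : Matrix (Fin 3) (Fin 3) ℝ) j k) (j k : Fin 3) :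
    MemLp (fun ω => ((crystalProjection (R ω : Matrix (Fin 3) (Fin 3) ℝ) j k : ℝ) : ℂ)) ∞ P := by
  have key : ∀ ω, crystalProjection (R ω : Matrix (Fin 3) (Fin 3) ℝ) j k =
      (R ω : Matrix (Fin 3) (Fin 3) ℝ) 0 j * (R ω : Matrix (Fin 3) (Fin 3) ℝ) 0 k := by
    intro ω
    simp [crystalProjection, Matrix.mul_apply, Matrix.diagonal, Fin.sum_univ_three]
  have bd : ∀ ω l, |(R ω : Matrix (Fin 3) (Fin 3) ℝ) 0 l| ≤ 1 := by
    intro ω l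
    have h := (Matrix.mem_orthogonalGroup_iff (Fin 3) ℝ).1
      (Matrix.mem_specialOrthogonalGroup_iff.1 (R ω).2).1
    have h0 := congrFun (congrFun h 0) 0
    simp [Matrix.mul_apply, Fin.sum_univ_three] at h0
    rw [abs_le_one_iff_mul_self_le_one]
    fin_cases l <;> simp <;> nlinarith [mul_self_nonneg ((R ω : Matrix (Fin 3) (Fin 3) ℝ) 0 0),
      mul_self_nonneg ((R ω : Matrix (Fin 3) (Fin 3) ℝ) 0 1),
      mul_self_nonneg ((R ω : Matrix (Fin 3) (Fin 3) ℝ) 0 2)]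
  refine memLp_top_of_bound ?_ 1 (Filter.Eventually.of_forall fun ω => ?_)
  · simp only [key]
    exact (Complex.measurable_ofReal.comp ((hR 0 j).mul (hR 0 k))).aestronglyMeasurable
  · rw [Complex.norm_real, key, Real.norm_eq_abs, abs_mul]
    exact mul_le_one₀ (bd ω j) (abs_nonneg _) (bd ω k)

/-- The operator of pointwise multiplication of vector fields by the random matrix
`X₁(ω) = R(ω)ᵀ C R(ω)`: `(X₁ ξ)_j(ω) = ∑_k X₁(ω)_{jk} ξ_k(ω)`. -/
def crystalOperator (P : Measure Ω) [IsProbabilityMeasure P]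
    (R : Ω → Matrix.specialOrthogonalGroup (Fin 3) ℝ)
    (hR : ∀ j k, Measurable fun ω => (R ω : Matrix (Fin 3) (Fin 3) ℝ) j k) :
    VectorL2 P →L[ℂ] VectorL2 P :=
  (PiLp.continuousLinearEquiv 2 ℂ (fun _ : Fin 3 => ScalarL2 P)).symm.toContinuousLinearMap ∘L
    ContinuousLinearMap.pi fun j =>
      ∑ k, mulOperator P (crystalProjection_memLp P R hR j k).toLp ∘L
        PiLp.proj 2 (fun _ : Fin 3 => ScalarL2 P) k

end Crystal

end StationaryField

end

noncomputable section

set_option linter.unusedSectionVars false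

open MeasureTheory Filter Topology
open scoped ENNReal InnerProductSpace

/-! Let `K` be the closure of the range of the curl. The curl is symmetric on `H1`: the generators
are skew, and the antisymmetry of the curl supplies a second sign. If `∇×∇×η = ∇×ξ`, then `ξ - ∇×η`
is curl-free, hence orthogonal to all curls, while `∇×η` is a curl. So `∇×η` is the orthogonal
projection of `ξ` onto `K`, and the bounded extension `Υ` is that projection
(`upsilonComposite_eq_starProjection`).

The work lies in the domain. The projection commutes with translations, hence preserves `H1`; it
leaves the curl unchanged, and a field of `K` in `H1` is divergence-free because gradients are
orthogonal to curls. For a divergence-free `η` one has `∇×∇×η = -Δη`, and `‖L_i L_j f‖ ≤ ‖Δf‖`;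
mollification and closedness of the generators then put `η` in `H2` as soon as `∇×η` is in `H1`
(`InH1.inH2`). Thus every curl in `H1` has a divergence-free potential in `H2` (`exists_inH2`). The
composite therefore fixes curls in `H1` and kills curl-free fields in `H1`, which gives its range
and, by the splitting along `K` and mollification, its dense domain.

Mollification, that is averaging over short times along the three axes, also turns weak curls into
strong ones, whence the adjoint of the curl is its closure. Injectivity of `∇×∇×` follows from
`‖∇ξ‖² = ‖∇×ξ‖² + ‖∇·ξ‖²`, since by ergodicity a mean-zero field with zero gradient vanishes.
Finally `X₁` is a pointwise orthogonal projection, so `X₁ΥX₁` is positive with norm at most 1. -/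

/-- Three commuting strongly continuous one-parameter groups of isometries of a Hilbert space. -/
structure IsCommutingFlow {H : Type*} [NormedAddCommGroup H] [InnerProductSpace ℂ H]
    (U : Fin 3 → ℝ → H →ₗᵢ[ℂ] H) : Prop where
  zero : ∀ i f, U i 0 f = f
  add : ∀ i s t f, U i (s + t) f = U i s (U i t f)
  comm : ∀ i j s t f, U i s (U j t f) = U j t (U i s f)
  cont : ∀ i f, Continuous fun t => U i t f

/-! ### Generators of commuting flows, time averages and mollification -/

namespace Flow

variable {H : Type*} [NormedAddCommGroup H] [InnerProductSpace ℂ H]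

/-- A bounded operator that commutes with a flow. -/
def Commutes (U : Fin 3 → ℝ → H →ₗᵢ[ℂ] H) (C : H →L[ℂ] H) : Prop :=
  ∀ i t f, C (U i t f) = U i t (C f)

section Basic

variable {U : Fin 3 → ℝ → H →ₗᵢ[ℂ] H} {C C' : H →L[ℂ] H}

theorem Commutes.comp (hC : Commutes U C) (hC' : Commutes U C') : Commutes U (C ∘L C') := by
  intro i t f
  simp only [ContinuousLinearMap.comp_apply, hC' i t, hC i t]

theorem Commutes.flow (hU : IsCommutingFlow U) (i : Fin 3) (t : ℝ) :
    Commutes U (U i t).toContinuousLinearMap :=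
  fun j s f => hU.comm i j t s f

theorem neg_apply (hU : IsCommutingFlow U) (i : Fin 3) (t : ℝ) (f : H) :
    U i t (U i (-t) f) = f := by
  rw [← hU.add, add_neg_cancel, hU.zero]

theorem inner_neg (hU : IsCommutingFlow U) (i : Fin 3) (t : ℝ) (f g : H) :
    ⟪f, U i t g⟫_ℂ = ⟪U i (-t) f, g⟫_ℂ := by
  rw [← (U i t).inner_map_map (U i (-t) f) g, neg_apply hU]

/-- The adjoint of `U i t` is its inverse `U i (-t)`, so commutation at `-t` becomes commutation of
the adjoints at `t`. -/
theorem Commutes.adjoint [CompleteSpace H] (hU : IsCommutingFlow U) (hC : Commutes U C) :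
    Commutes U (ContinuousLinearMap.adjoint C) := by
  intro i t f
  refine ext_inner_right ℂ fun g => ?_
  have h := inner_neg hU i (-t) (ContinuousLinearMap.adjoint C f) g
  rw [neg_neg] at h
  have h' := inner_neg hU i (-t) f (C g)
  rw [neg_neg] at h'
  rw [ContinuousLinearMap.adjoint_inner_left, ← h, ContinuousLinearMap.adjoint_inner_left,
    hC i, h']

end Basic

variable [NormedSpace ℝ H]

/-- The derivative at `0` of the `i`-th flow along `f` exists. -/
def Diff (U : Fin 3 → ℝ → H →ₗᵢ[ℂ] H) (i : Fin 3) (f : H) : Prop :=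
  DifferentiableAt ℝ (fun t : ℝ => U i t f) 0

/-- The derivative at `0` of the `i`-th flow along `f`. -/
def D (U : Fin 3 → ℝ → H →ₗᵢ[ℂ] H) (i : Fin 3) (f : H) : H :=
  deriv (fun t : ℝ => U i t f) 0

variable {U : Fin 3 → ℝ → H →ₗᵢ[ℂ] H} {C : H →L[ℂ] H} {i j : Fin 3} {f g : H}

theorem Diff.hasDerivAt_zero (hf : Diff U i f) : HasDerivAt (fun t => U i t f) (D U i f) 0 :=
  DifferentiableAt.hasDerivAt hf

theorem Diff.add (hf : Diff U i f) (hg : Diff U i g) : Diff U i (f + g) := by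
  simpa only [Diff, LinearIsometry.map_add] using DifferentiableAt.fun_add hf hg

theorem Diff.sub (hf : Diff U i f) (hg : Diff U i g) : Diff U i (f - g) := by
  simpa only [Diff, map_sub] using DifferentiableAt.fun_sub hf hg

theorem D_add (hf : Diff U i f) (hg : Diff U i g) : D U i (f + g) = D U i f + D U i g := by
  simpa only [D, LinearIsometry.map_add] using deriv_fun_add hf hg

theorem D_sub (hf : Diff U i f) (hg : Diff U i g) : D U i (f - g) = D U i f - D U i g := by
  simpa only [D, map_sub] using deriv_fun_sub hf hg

theorem D_zero : D U i (0 : H) = 0 := by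
  simp [D]

variable [IsScalarTower ℝ ℂ H]

/-- Apply the bounded operator `C` to the difference quotient. This is how averages and mollifiers
preserve differentiability. -/
theorem Commutes.hasDerivAt (hC : Commutes U C) (hf : Diff U i f) :
    HasDerivAt (fun t => U i t (C f)) (C (D U i f)) 0 := by
  have h := ((C.restrictScalars ℝ).hasFDerivAt).comp_hasDerivAt (0 : ℝ) hf.hasDerivAt_zero
  refine h.congr_of_eventuallyEq (Eventually.of_forall fun t => ?_)
  exact (hC i t f).symm

theorem Commutes.diff (hC : Commutes U C) (hf : Diff U i f) : Diff U i (C f) :=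
  (hC.hasDerivAt hf).differentiableAt

theorem Commutes.D_apply (hC : Commutes U C) (hf : Diff U i f) : D U i (C f) = C (D U i f) :=
  (hC.hasDerivAt hf).deriv

theorem Diff.hasDerivAt (hU : IsCommutingFlow U) (hf : Diff U i f) (t : ℝ) :
    HasDerivAt (fun s => U i s f) (U i t (D U i f)) t := by
  have h := (Commutes.flow hU i t).hasDerivAt hf
  -- The point `0` is written as `t - t` so that the time shift by `t` can be applied.
  have h' : HasDerivAt (fun s : ℝ => U i s (U i t f)) (U i t (D U i f)) (t - t) := by
    rw [sub_self]; exact h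
  have h2 := HasDerivAt.comp_sub_const (f := fun s : ℝ => U i s (U i t f)) t t h'
  refine h2.congr_of_eventuallyEq (Eventually.of_forall fun s => ?_)
  change _ = U i (s - t) (U i t f)
  rw [← hU.add, sub_add_cancel]

/-- Differentiate the constant function `t ↦ ⟪U i t f, U i t g⟫`. -/
theorem inner_D (hU : IsCommutingFlow U) (hf : Diff U i f) (hg : Diff U i g) :
    ⟪D U i f, g⟫_ℂ = -⟪f, D U i g⟫_ℂ := by
  have h := HasDerivAt.inner ℂ hf.hasDerivAt_zero hg.hasDerivAt_zero
  simp only [LinearIsometry.inner_map_map, hU.zero] at h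
  have h0 := h.unique (hasDerivAt_const (0 : ℝ) (⟪f, g⟫_ℂ))
  exact eq_neg_of_add_eq_zero_right h0

theorem flow_eq_of_D_eq_zero (hU : IsCommutingFlow U) (hf : Diff U i f) (h : D U i f = 0)
    (t : ℝ) : U i t f = f := by
  have hd : ∀ s, HasDerivAt (fun s => U i s f) 0 s := by
    intro s
    simpa [h] using hf.hasDerivAt hU s
  have := is_const_of_deriv_eq_zero (fun s => (hd s).differentiableAt) (fun s => (hd s).deriv) t 0
  simpa [hU.zero] using this

variable [CompleteSpace H]

/-- The average of the `i`-th flow over times between `0` and `h`. -/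
def avg (U : Fin 3 → ℝ → H →ₗᵢ[ℂ] H) (hU : IsCommutingFlow U) (i : Fin 3) (h : ℝ) : H →L[ℂ] H :=
  LinearMap.mkContinuous
    { toFun := fun f => h⁻¹ • ∫ t in (0 : ℝ)..h, U i t f
      map_add' := by
        intro f g
        simp only [LinearIsometry.map_add]
        rw [intervalIntegral.integral_add ((hU.cont i f).intervalIntegrable _ _)
          ((hU.cont i g).intervalIntegrable _ _), smul_add]
      map_smul' := by
        intro c f
        simp only [LinearIsometry.map_smul, RingHom.id_apply]
        rw [intervalIntegral.integral_smul, smul_comm] } 1 (by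
    intro f
    have h1 : ‖∫ t in (0 : ℝ)..h, U i t f‖ ≤ ‖f‖ * |h - 0| :=
      intervalIntegral.norm_integral_le_of_norm_le_const fun t _ => by
        rw [LinearIsometry.norm_map]
    simp only [LinearMap.coe_mk, AddHom.coe_mk, norm_smul, norm_inv, Real.norm_eq_abs, one_mul]
    rw [sub_zero] at h1
    calc |h|⁻¹ * ‖∫ t in (0 : ℝ)..h, U i t f‖ ≤ |h|⁻¹ * (‖f‖ * |h|) := by gcongr
      _ = ‖f‖ * (|h|⁻¹ * |h|) := by ring
      -- The inequality includes `h = 0`, where `h⁻¹ = 0` and the average is the zero operator.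
      _ ≤ ‖f‖ * 1 := by gcongr; exact inv_mul_le_one
      _ = ‖f‖ := mul_one _)

theorem avg_apply (hU : IsCommutingFlow U) (h : ℝ) (f : H) :
    avg U hU i h f = h⁻¹ • ∫ t in (0 : ℝ)..h, U i t f := rfl

theorem norm_avg_le (hU : IsCommutingFlow U) (h : ℝ) (f : H) : ‖avg U hU i h f‖ ≤ ‖f‖ := by
  have h1 := (avg U hU i h).le_of_opNorm_le (LinearMap.mkContinuous_norm_le _ zero_le_one _) f
  simpa using h1

theorem apply_avg (hU : IsCommutingFlow U) (hC : Commutes U C) (h : ℝ) (f : H) :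
    C (avg U hU i h f) = avg U hU i h (C f) := by
  rw [avg_apply, avg_apply]
  have h1 := ((C.restrictScalars ℝ).map_smul h⁻¹ (∫ t in (0 : ℝ)..h, U i t f))
  change C _ = h⁻¹ • C _ at h1
  rw [h1, ← ContinuousLinearMap.intervalIntegral_comp_comm C
    ((hU.cont i f).intervalIntegrable _ _)]
  simp only [hC i]

theorem Commutes.avg (hU : IsCommutingFlow U) (i : Fin 3) (h : ℝ) :
    Commutes U (avg U hU i h) :=
  fun j t f => (apply_avg hU (Commutes.flow hU j t) h f).symm

theorem hasDerivAt_primitive (hU : IsCommutingFlow U) (i : Fin 3) (f : H) (t : ℝ) :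
    HasDerivAt (fun u : ℝ => ∫ s in (0 : ℝ)..u, U i s f) (U i t f) t :=
  intervalIntegral.integral_hasDerivAt_right ((hU.cont i f).intervalIntegrable _ _)
    (hU.cont i f).stronglyMeasurable.stronglyMeasurableAtFilter (hU.cont i f).continuousAt

/-- The orbit of the average is `h⁻¹ ∫ U i s f` over `[t, t + h]`, so the fundamental theorem of
calculus applies with no condition on `f`. -/
theorem hasDerivAt_avg (hU : IsCommutingFlow U) (i : Fin 3) (h : ℝ) (f : H) :
    HasDerivAt (fun t => U i t (avg U hU i h f)) (h⁻¹ • (U i h f - f)) 0 := by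
  have key : ∀ t, U i t (avg U hU i h f) =
      h⁻¹ • ((∫ s in (0 : ℝ)..(t + h), U i s f) - ∫ s in (0 : ℝ)..t, U i s f) := by
    intro t
    rw [intervalIntegral.integral_interval_sub_left ((hU.cont i f).intervalIntegrable _ _)
      ((hU.cont i f).intervalIntegrable _ _)]
    have h1 := apply_avg (i := i) hU (Commutes.flow hU i t) h f
    simp only [LinearIsometry.coe_toContinuousLinearMap] at h1
    rw [h1, avg_apply]
    simp only [← hU.add, add_comm _ t]
    rw [intervalIntegral.integral_comp_add_left (fun s => U i s f) t, add_zero]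
  have h2 : HasDerivAt (fun t : ℝ => ∫ s in (0 : ℝ)..(t + h), U i s f) (U i h f) 0 := by
    have := hasDerivAt_primitive hU i f (0 + h)
    have h3 := HasDerivAt.comp_add_const (f := fun u : ℝ => ∫ s in (0 : ℝ)..u, U i s f) 0 h this
    simpa using h3
  have h3 := (h2.sub (hasDerivAt_primitive hU i f 0)).const_smul h⁻¹
  rw [hU.zero] at h3
  exact h3.congr_of_eventuallyEq (Eventually.of_forall key)

theorem diff_avg (hU : IsCommutingFlow U) (i : Fin 3) (h : ℝ) (f : H) :
    Diff U i (avg U hU i h f) :=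
  (hasDerivAt_avg hU i h f).differentiableAt

/-- The integrated form of `D U i f = g` involves bounded operators only, so it survives limits;
`hasDerivAt_of_avg` is the converse. Together they make the generators closed. -/
theorem avg_D (hU : IsCommutingFlow U) (hf : Diff U i f) (h : ℝ) :
    avg U hU i h (D U i f) = h⁻¹ • (U i h f - f) := by
  rw [← (Commutes.avg hU i h).D_apply hf]
  exact (hasDerivAt_avg hU i h f).deriv

theorem tendsto_avg (hU : IsCommutingFlow U) (i : Fin 3) (f : H) :
    Tendsto (fun h => avg U hU i h f) (𝓝[≠] 0) (𝓝 f) := by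
  have h := hasDerivAt_iff_tendsto_slope_zero.1 (hasDerivAt_primitive hU i f 0)
  simpa [hU.zero, avg_apply] using h

theorem hasDerivAt_of_avg (hU : IsCommutingFlow U)
    (h : ∀ t, avg U hU i t g = t⁻¹ • (U i t f - f)) : HasDerivAt (fun t => U i t f) g 0 := by
  rw [hasDerivAt_iff_tendsto_slope_zero]
  simpa [hU.zero, ← h] using tendsto_avg hU i g

/-- The generators are closed. -/
theorem hasDerivAt_of_tendsto (hU : IsCommutingFlow U) {u : ℕ → H} (hu : ∀ n, Diff U i (u n))
    (hf : Tendsto u atTop (𝓝 f)) (hg : Tendsto (fun n => D U i (u n)) atTop (𝓝 g)) :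
    HasDerivAt (fun t => U i t f) g 0 := by
  refine hasDerivAt_of_avg hU fun t => ?_
  refine tendsto_nhds_unique (((avg U hU i t).continuous.tendsto g).comp hg) ?_
  have h1 := (((U i t).continuous.tendsto f).comp hf).sub hf
  have h2 := h1.const_smul t⁻¹
  refine h2.congr fun n => ?_
  exact (avg_D hU (hu n) t).symm

/-- Averaging both mixed derivatives in both directions gives the same second difference of `f`,
because the flows commute. Letting `h → 0` removes the averages. -/
theorem D_comm (hU : IsCommutingFlow U) (hi : Diff U i f) (hj : Diff U j f)
    (hij : Diff U i (D U j f)) (hji : Diff U j (D U i f)) :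
    D U i (D U j f) = D U j (D U i f) := by
  have key : ∀ i j : Fin 3, Diff U j f → Diff U i (D U j f) → ∀ h,
      avg U hU i h (avg U hU j h (D U i (D U j f))) =
        h⁻¹ • (h⁻¹ • (U i h (U j h f) - U i h f) - h⁻¹ • (U j h f - f)) := by
    intro i j hj hij h
    rw [apply_avg hU (Commutes.avg hU i h), avg_D hU hij]
    have h1 := ((avg U hU j h).restrictScalars ℝ).map_smul h⁻¹ (U i h (D U j f) - D U j f)
    change avg U hU j h _ = h⁻¹ • avg U hU j h _ at h1
    have h2 := ((U i h).toContinuousLinearMap.restrictScalars ℝ).map_smul h⁻¹ (U j h f - f)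
    change U i h _ = h⁻¹ • U i h _ at h2
    rw [h1, map_sub, Commutes.avg hU j h i h, avg_D hU hj, h2, map_sub]
  have lim : ∀ i j : Fin 3, ∀ g, Tendsto (fun h => avg U hU i h (avg U hU j h g)) (𝓝[≠] 0)
      (𝓝 g) := by
    intro i j g
    have h1 : Tendsto (fun h => avg U hU i h (avg U hU j h g - g)) (𝓝[≠] 0) (𝓝 0) := by
      refine squeeze_zero_norm (fun h => norm_avg_le hU h _) ?_
      simpa using ((tendsto_avg hU j g).sub_const g).norm
    simpa using h1.add (tendsto_avg hU i g)
  refine tendsto_nhds_unique (lim i j _) ((lim j i _).congr fun h => ?_)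
  rw [key i j hj hij, key j i hi hji, hU.comm i j]
  congr 1
  rw [← smul_sub, ← smul_sub]
  congr 1
  abel

/-- The composition of the averages over times up to `1 / (n + 1)` along the three flows. -/
def mollify (U : Fin 3 → ℝ → H →ₗᵢ[ℂ] H) (hU : IsCommutingFlow U) (n : ℕ) : H →L[ℂ] H :=
  avg U hU 0 (1 / (n + 1 : ℝ)) ∘L avg U hU 1 (1 / (n + 1 : ℝ)) ∘L avg U hU 2 (1 / (n + 1 : ℝ))

theorem Commutes.mollify (hU : IsCommutingFlow U) (n : ℕ) : Commutes U (mollify U hU n) :=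
  (Commutes.avg hU 0 _).comp ((Commutes.avg hU 1 _).comp (Commutes.avg hU 2 _))

theorem norm_mollify_le (hU : IsCommutingFlow U) (n : ℕ) (f : H) : ‖mollify U hU n f‖ ≤ ‖f‖ :=
  ((norm_avg_le hU _ _).trans (norm_avg_le hU _ _)).trans (norm_avg_le hU _ _)

/-- The average in direction `i` creates the derivative; any averages outside it commute with the
flow and keep it. -/
theorem diff_mollify (hU : IsCommutingFlow U) (i : Fin 3) (n : ℕ) (f : H) :
    Diff U i (mollify U hU n f) := by
  have h0 := Commutes.avg hU 0 (1 / (n + 1 : ℝ))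
  have h1 := Commutes.avg hU 1 (1 / (n + 1 : ℝ))
  fin_cases i
  · exact diff_avg hU 0 _ _
  · exact h0.diff (diff_avg hU 1 _ _)
  · exact h0.diff (h1.diff (diff_avg hU 2 _ _))

theorem tendsto_mollify (hU : IsCommutingFlow U) (f : H) :
    Tendsto (fun n => mollify U hU n f) atTop (𝓝 f) := by
  have h0 : Tendsto (fun n : ℕ => 1 / (n + 1 : ℝ)) atTop (𝓝[≠] 0) :=
    tendsto_nhdsWithin_iff.2 ⟨tendsto_one_div_add_atTop_nhds_zero_nat,
      Eventually.of_forall fun n => by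
        simp only [Set.mem_compl_iff, Set.mem_singleton_iff]; positivity⟩
  have step : ∀ (i : Fin 3) (u : ℕ → H), Tendsto u atTop (𝓝 f) →
      Tendsto (fun n : ℕ => avg U hU i (1 / (n + 1 : ℝ)) (u n)) atTop (𝓝 f) := by
    intro i u hu
    have h1 : Tendsto (fun n : ℕ => avg U hU i (1 / (n + 1 : ℝ)) (u n - f)) atTop (𝓝 0) := by
      refine squeeze_zero_norm (fun n => norm_avg_le hU _ _) ?_
      simpa using (hu.sub_const f).norm
    simpa using h1.add ((tendsto_avg hU i f).comp h0)
  exact step 0 _ (step 1 _ ((tendsto_avg hU 2 f).comp h0))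

/-- Mollifiers are contractions, so they may act on a moving argument. The case of use is the double
mollification, which gains two derivatives. -/
theorem tendsto_mollify_of_tendsto (hU : IsCommutingFlow U) {u : ℕ → H}
    (hu : Tendsto u atTop (𝓝 f)) : Tendsto (fun n => mollify U hU n (u n)) atTop (𝓝 f) := by
  have h1 : Tendsto (fun n : ℕ => mollify U hU n (u n - f)) atTop (𝓝 0) := by
    refine squeeze_zero_norm (fun n => norm_mollify_le hU _ _) ?_
    simpa using (hu.sub_const f).norm
  simpa using h1.add (tendsto_mollify hU f)

theorem D_mollify (hU : IsCommutingFlow U) (n : ℕ) (hf : Diff U i f) :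
    D U i (mollify U hU n f) = mollify U hU n (D U i f) :=
  (Commutes.mollify hU n).D_apply hf

end Flow

/-! ### Ergodic flows, mean-zero fields, curl and divergence -/

/-- A commuting flow of isometries whose invariant vectors are the multiples of a unit vector `e`. -/
structure IsErgodicFlow {H : Type*} [NormedAddCommGroup H] [InnerProductSpace ℂ H]
    (U : Fin 3 → ℝ → H →ₗᵢ[ℂ] H) (e : H) : Prop extends IsCommutingFlow U where
  fixed : ∀ i t, U i t e = e
  norm_eq_one : ‖e‖ = 1
  eq_zero : ∀ f, (∀ i t, U i t f = f) → ⟪e, f⟫_ℂ = 0 → f = 0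

namespace Flow

variable {H : Type*} [NormedAddCommGroup H] [InnerProductSpace ℂ H]

/-- Fields all of whose components are orthogonal to `e`. -/
def MeanZero (e : H) (ξ : PiLp 2 fun _ : Fin 3 => H) : Prop :=
  ∀ k, ⟪e, ξ k⟫_ℂ = 0

/-- The operator acting as `C` on each component. -/
def lift (C : H →L[ℂ] H) :
    (PiLp 2 fun _ : Fin 3 => H) →L[ℂ] PiLp 2 fun _ : Fin 3 => H :=
  (PiLp.continuousLinearEquiv 2 ℂ (fun _ : Fin 3 => H)).symm.toContinuousLinearMap ∘L
    ContinuousLinearMap.pi fun j => C ∘L PiLp.proj 2 (fun _ : Fin 3 => H) j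

theorem lift_apply (C : H →L[ℂ] H) (ξ : PiLp 2 fun _ : Fin 3 => H) (k : Fin 3) :
    lift C ξ k = C (ξ k) := rfl

theorem inner_lift [CompleteSpace H] (C : H →L[ℂ] H) (ξ ζ : PiLp 2 fun _ : Fin 3 => H) :
    ⟪lift C ξ, ζ⟫_ℂ = ⟪ξ, lift (ContinuousLinearMap.adjoint C) ζ⟫_ℂ := by
  simp only [PiLp.inner_apply, lift_apply, ContinuousLinearMap.adjoint_inner_right]

theorem tendsto_piLp_iff {α : Type*} {l : Filter α} {u : α → PiLp 2 fun _ : Fin 3 => H}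
    {x : PiLp 2 fun _ : Fin 3 => H} :
    Tendsto u l (𝓝 x) ↔ ∀ k, Tendsto (fun a => u a k) l (𝓝 (x k)) := by
  rw [(PiLp.homeomorph 2 fun _ : Fin 3 => H).isInducing.tendsto_nhds_iff, tendsto_pi_nhds]
  rfl

section Mean

variable {e : H} {U : Fin 3 → ℝ → H →ₗᵢ[ℂ] H} {C : H →L[ℂ] H}
  {ξ ζ η : PiLp 2 fun _ : Fin 3 => H}

theorem MeanZero.sub (hξ : MeanZero e ξ) (hζ : MeanZero e ζ) : MeanZero e (ξ - ζ) := by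
  intro k
  simp [hξ k, hζ k]

theorem isClosed_meanZero (e : H) : IsClosed {ξ | MeanZero e ξ} := by
  simp only [MeanZero, Set.ofPred_forall]
  refine isClosed_iInter fun k => isClosed_eq ?_ continuous_const
  exact continuous_const.inner (PiLp.continuous_apply 2 _ k)

variable [CompleteSpace H]

/-- The vector `C* e` is invariant because `C*` commutes with the flow, so by ergodicity it is a
multiple of `e`. -/
theorem Commutes.inner_eq_zero (hU : IsErgodicFlow U e) (hC : Commutes U C) {f : H}
    (hf : ⟪e, f⟫_ℂ = 0) : ⟪e, C f⟫_ℂ = 0 := by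
  set g := ContinuousLinearMap.adjoint C e with hg
  have hg1 : ∀ i t, U i t g = g := by
    intro i t
    rw [hg, ← hC.adjoint hU.toIsCommutingFlow i t, hU.fixed]
  have h0 : g - ⟪e, g⟫_ℂ • e = 0 := by
    refine hU.eq_zero _ (fun i t => ?_) ?_
    · rw [map_sub, LinearIsometry.map_smul, hg1, hU.fixed]
    · rw [inner_sub_right, inner_smul_right, inner_self_eq_norm_sq_to_K, hU.norm_eq_one]
      simp
  rw [← ContinuousLinearMap.adjoint_inner_left, ← hg, sub_eq_zero.1 h0, inner_smul_left, hf,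
    mul_zero]

theorem MeanZero.map (hU : IsErgodicFlow U e) (hC : Commutes U C) (hξ : MeanZero e ξ) :
    MeanZero e (lift C ξ) :=
  fun k => hC.inner_eq_zero hU (hξ k)

end Mean

variable [NormedSpace ℝ H]

/-- Fields with mean zero whose components are differentiable in all directions. -/
def InH1 (U : Fin 3 → ℝ → H →ₗᵢ[ℂ] H) (e : H) (ξ : PiLp 2 fun _ : Fin 3 => H) : Prop :=
  ∀ k, (∀ i, Diff U i (ξ k)) ∧ ⟪e, ξ k⟫_ℂ = 0

/-- The curl. -/
def rot (U : Fin 3 → ℝ → H →ₗᵢ[ℂ] H) (ξ : PiLp 2 fun _ : Fin 3 => H) :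
    PiLp 2 fun _ : Fin 3 => H :=
  WithLp.toLp 2 ![D U 1 (ξ 2) - D U 2 (ξ 1), D U 2 (ξ 0) - D U 0 (ξ 2),
    D U 0 (ξ 1) - D U 1 (ξ 0)]

/-- The divergence. -/
def dv (U : Fin 3 → ℝ → H →ₗᵢ[ℂ] H) (ξ : PiLp 2 fun _ : Fin 3 => H) : H :=
  ∑ i, D U i (ξ i)

/-- Fields in `InH1` with second derivatives. -/
def InH2 (U : Fin 3 → ℝ → H →ₗᵢ[ℂ] H) (e : H) (ξ : PiLp 2 fun _ : Fin 3 => H) : Prop :=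
  InH1 U e ξ ∧ ∀ i j k, Diff U i (D U j (ξ k))

variable {U : Fin 3 → ℝ → H →ₗᵢ[ℂ] H} {e : H} {C : H →L[ℂ] H}
  {ξ ζ η : PiLp 2 fun _ : Fin 3 => H}

theorem rot_zero : rot U ξ 0 = D U 1 (ξ 2) - D U 2 (ξ 1) := rfl
theorem rot_one : rot U ξ 1 = D U 2 (ξ 0) - D U 0 (ξ 2) := rfl
theorem rot_two : rot U ξ 2 = D U 0 (ξ 1) - D U 1 (ξ 0) := rfl

theorem ext_fin_three (h0 : ξ 0 = ζ 0) (h1 : ξ 1 = ζ 1) (h2 : ξ 2 = ζ 2) : ξ = ζ := by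
  ext k
  fin_cases k
  exacts [h0, h1, h2]

theorem InH1.diff (hξ : InH1 U e ξ) (i k : Fin 3) : Diff U i (ξ k) := (hξ k).1 i

theorem InH1.meanZero (hξ : InH1 U e ξ) : MeanZero e ξ := fun k => (hξ k).2

theorem InH1.sub (hξ : InH1 U e ξ) (hζ : InH1 U e ζ) : InH1 U e (ξ - ζ) :=
  fun k => ⟨fun i => (hξ.diff i k).sub (hζ.diff i k), hξ.meanZero.sub hζ.meanZero k⟩

theorem rot_sub (hξ : InH1 U e ξ) (hζ : InH1 U e ζ) : rot U (ξ - ζ) = rot U ξ - rot U ζ := by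
  refine ext_fin_three ?_ ?_ ?_ <;>
  · simp only [rot_zero, rot_one, rot_two, PiLp.sub_apply, D_sub (hξ.diff _ _) (hζ.diff _ _)]
    abel

theorem InH2.inH1_rot (hξ : InH2 U e ξ) (h0 : MeanZero e (rot U ξ)) :
    InH1 U e (rot U ξ) := by
  refine fun k => ⟨fun i => ?_, h0 k⟩
  fin_cases k
  exacts [(hξ.2 _ _ _).sub (hξ.2 _ _ _), (hξ.2 _ _ _).sub (hξ.2 _ _ _),
    (hξ.2 _ _ _).sub (hξ.2 _ _ _)]

variable [IsScalarTower ℝ ℂ H]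

theorem inner_D_eq_zero (hU : IsErgodicFlow U e) {i : Fin 3} {f : H} (hf : Diff U i f) :
    ⟪e, D U i f⟫_ℂ = 0 := by
  have he : Diff U i e := by simp [Diff, hU.fixed]
  have h1 : D U i e = 0 := by simp [D, hU.fixed]
  have h := inner_D hU.toIsCommutingFlow he hf
  rw [h1, inner_zero_left] at h
  exact neg_eq_zero.1 h.symm

theorem meanZero_rot (hU : IsErgodicFlow U e) (hξ : InH1 U e ξ) : MeanZero e (rot U ξ) := by
  intro k
  fin_cases k
  · simp [rot_zero, inner_D_eq_zero hU (hξ.diff _ _)]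
  · simp [rot_one, inner_D_eq_zero hU (hξ.diff _ _)]
  · simp [rot_two, inner_D_eq_zero hU (hξ.diff _ _)]

theorem rot_lift (hC : Commutes U C) (hξ : InH1 U e ξ) : rot U (lift C ξ) = lift C (rot U ξ) := by
  refine ext_fin_three ?_ ?_ ?_ <;>
  simp only [rot_zero, rot_one, rot_two, lift_apply, hC.D_apply (hξ.diff _ _), map_sub]

theorem dv_lift (hC : Commutes U C) (hξ : InH1 U e ξ) : dv U (lift C ξ) = C (dv U ξ) := by
  simp only [dv, lift_apply, hC.D_apply (hξ.diff _ _), map_sum]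

/-- Skewness of each derivative and antisymmetry of the curl in its indices contribute two signs
that cancel. -/
theorem inner_rot (hU : IsErgodicFlow U e) (hξ : InH1 U e ξ) (hζ : InH1 U e ζ) :
    ⟪rot U ξ, ζ⟫_ℂ = ⟪ξ, rot U ζ⟫_ℂ := by
  simp only [PiLp.inner_apply, Fin.sum_univ_three, rot_zero, rot_one, rot_two, inner_sub_left,
    inner_sub_right, inner_D hU.toIsCommutingFlow (hξ.diff _ _) (hζ.diff _ _)]
  ring

variable [CompleteSpace H]

theorem InH1.map (hU : IsErgodicFlow U e) (hC : Commutes U C) (hξ : InH1 U e ξ) :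
    InH1 U e (lift C ξ) :=
  fun k => ⟨fun i => hC.diff (hξ.diff i k), hξ.meanZero.map hU hC k⟩

theorem inH1_mollify (hU : IsErgodicFlow U e) (n : ℕ) (hξ : MeanZero e ξ) :
    InH1 U e (lift (mollify U hU.toIsCommutingFlow n) ξ) :=
  fun k => ⟨fun i => diff_mollify _ i n _, hξ.map hU (Commutes.mollify _ n) k⟩

theorem tendsto_lift_mollify (hU : IsCommutingFlow U) (ξ : PiLp 2 fun _ : Fin 3 => H) :
    Tendsto (fun n => lift (mollify U hU n) ξ) atTop (𝓝 ξ) :=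
  tendsto_piLp_iff.2 fun k => tendsto_mollify hU (ξ k)

theorem eq_zero_of_inner_eq_zero (hU : IsErgodicFlow U e) (hη : MeanZero e η)
    (h : ∀ ξ, InH1 U e ξ → ⟪ξ, η⟫_ℂ = 0) : η = 0 := by
  have h1 := (tendsto_lift_mollify hU.toIsCommutingFlow η).inner (𝕜 := ℂ) (tendsto_const_nhds (x := η))
  simp only [h _ (inH1_mollify hU _ hη)] at h1
  exact inner_self_eq_zero.1 (tendsto_nhds_unique h1 tendsto_const_nhds)

/-- The difference of the strong and the weak curl has mean zero and is orthogonal to `InH1`, which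
is dense among mean-zero fields by mollification. -/
theorem rot_eq_of_inner (hU : IsErgodicFlow U e) (hξ : InH1 U e ξ) (hη : MeanZero e η)
    (h : ∀ φ, InH1 U e φ → ⟪rot U φ, ξ⟫_ℂ = ⟪φ, η⟫_ℂ) : rot U ξ = η := by
  refine sub_eq_zero.1 (eq_zero_of_inner_eq_zero hU ((meanZero_rot hU hξ).sub hη) fun φ hφ => ?_)
  rw [inner_sub_right, ← inner_rot hU hφ hξ, h φ hφ, sub_self]

/-- A weak curl is a curl after mollification. -/
theorem rot_mollify (hU : IsErgodicFlow U e) (n : ℕ) (hζ : MeanZero e ζ) (hη : MeanZero e η)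
    (h : ∀ φ, InH1 U e φ → ⟪rot U φ, ζ⟫_ℂ = ⟪φ, η⟫_ℂ) :
    rot U (lift (mollify U hU.toIsCommutingFlow n) ζ) =
      lift (mollify U hU.toIsCommutingFlow n) η := by
  have hS := Commutes.mollify hU.toIsCommutingFlow n
  refine rot_eq_of_inner hU (inH1_mollify hU n hζ) (hη.map hU hS) fun φ hφ => ?_
  -- The mollifier moves onto the test field as its adjoint, which again commutes with the flow and
  -- hence with the curl.
  have hS' := hS.adjoint hU.toIsCommutingFlow
  have h1 := h _ (hφ.map hU hS')
  rw [rot_lift hS' hφ, inner_lift, inner_lift, ContinuousLinearMap.adjoint_adjoint] at h1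
  exact h1

/-- A weak pair is the limit of its mollifications, which lie in the graph. Conversely the pairing
identity is a closed condition, and it holds on the graph by `inner_rot`. -/
theorem adjoint_rot_iff (hU : IsErgodicFlow U e) (hζ : MeanZero e ζ) (hη : MeanZero e η) :
    (∀ φ, InH1 U e φ → ⟪rot U φ, ζ⟫_ℂ = ⟪φ, η⟫_ℂ) ↔
      (ζ, η) ∈ closure {p : (PiLp 2 fun _ : Fin 3 => H) × PiLp 2 fun _ : Fin 3 => H |
        InH1 U e p.1 ∧ rot U p.1 = p.2} := by
  constructor
  · intro h
    refine mem_closure_of_tendsto ((tendsto_lift_mollify hU.toIsCommutingFlow ζ).prodMk_nhds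
      (tendsto_lift_mollify hU.toIsCommutingFlow η)) (Eventually.of_forall fun n => ?_)
    exact ⟨inH1_mollify hU n hζ, rot_mollify hU n hζ hη h⟩
  · intro h φ hφ
    refine closure_minimal (s := {p : (PiLp 2 fun _ : Fin 3 => H) × PiLp 2 fun _ : Fin 3 => H |
        InH1 U e p.1 ∧ rot U p.1 = p.2})
      (t := {p | ⟪rot U φ, p.1⟫_ℂ = ⟪φ, p.2⟫_ℂ}) ?_ ?_ h
    · rintro ⟨a, b⟩ ⟨ha, hb⟩
      simp only at ha hb
      subst hb
      exact inner_rot hU hφ ha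
    · exact isClosed_eq (continuous_const.inner continuous_fst)
        (continuous_const.inner continuous_snd)

/-- The cross terms of the squared curl match those of the squared divergence: integrate by parts
and exchange the two derivatives. -/
theorem rot_add_dv_norm (hU : IsErgodicFlow U e) (hξ : InH2 U e ξ) :
    ∑ k, ∑ j, ⟪D U j (ξ k), D U j (ξ k)⟫_ℂ =
      ⟪rot U ξ, rot U ξ⟫_ℂ + ⟪dv U ξ, dv U ξ⟫_ℂ := by
  have key : ∀ j k, ⟪D U j (ξ k), D U k (ξ j)⟫_ℂ = ⟪D U k (ξ k), D U j (ξ j)⟫_ℂ := by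
    intro j k
    rw [inner_D hU.toIsCommutingFlow (hξ.1.diff _ _) (hξ.2 _ _ _),
      inner_D hU.toIsCommutingFlow (hξ.1.diff _ _) (hξ.2 _ _ _),
      D_comm hU.toIsCommutingFlow (hξ.1.diff _ _) (hξ.1.diff _ _) (hξ.2 _ _ _) (hξ.2 _ _ _)]
  simp only [PiLp.inner_apply, dv, Fin.sum_univ_three, rot_zero, rot_one, rot_two, inner_sub_left,
    inner_sub_right, inner_add_left, inner_add_right]
  linear_combination (exp := 1) key 0 1 + key 1 0 + key 0 2 + key 2 0 + key 1 2 + key 2 1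

theorem InH1.eq_zero_of_D_eq_zero (hU : IsErgodicFlow U e) (hξ : InH1 U e ξ)
    (h : ∀ j k, D U j (ξ k) = 0) : ξ = 0 := by
  ext k
  exact hU.eq_zero _ (fun i t => flow_eq_of_D_eq_zero hU.toIsCommutingFlow (hξ.diff i k) (h i k) t)
    (hξ.meanZero k)

/-- Pairing `∇×∇×ξ = 0` with `ξ` gives `∇×ξ = 0`. With zero divergence, `rot_add_dv_norm` then
annihilates every first derivative. -/
theorem InH2.eq_zero (hU : IsErgodicFlow U e) (hξ : InH2 U e ξ) (hdv : dv U ξ = 0)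
    (h : rot U (rot U ξ) = 0) : ξ = 0 := by
  have h1 : ⟪rot U ξ, rot U ξ⟫_ℂ = 0 := by
    rw [inner_rot hU hξ.1 (hξ.inH1_rot (meanZero_rot hU hξ.1)), h, inner_zero_right]
  have h2 := congrArg Complex.re (rot_add_dv_norm hU hξ)
  rw [h1, hdv, inner_zero_left, add_zero, Complex.zero_re] at h2
  simp only [Complex.re_sum] at h2
  refine hξ.1.eq_zero_of_D_eq_zero hU fun j k => ?_
  have nn : ∀ x : H, 0 ≤ (⟪x, x⟫_ℂ).re := fun x => inner_self_nonneg (𝕜 := ℂ)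
  have h3 := (Finset.sum_eq_zero_iff_of_nonneg fun k _ => Finset.sum_nonneg fun j _ => nn _).1 h2 k
    (Finset.mem_univ _)
  have h4 := (Finset.sum_eq_zero_iff_of_nonneg fun j _ => nn _).1 h3 j (Finset.mem_univ _)
  exact (re_inner_self_nonpos (𝕜 := ℂ)).1 h4.le

end Flow

/-! ### Elliptic regularity for divergence-free fields -/

namespace Flow

variable {H : Type*} [NormedAddCommGroup H] [InnerProductSpace ℂ H]

theorem Commutes.sub {U : Fin 3 → ℝ → H →ₗᵢ[ℂ] H} {C C' : H →L[ℂ] H} (hC : Commutes U C)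
    (hC' : Commutes U C') : Commutes U (C - C') := by
  intro i t f
  simp only [sub_apply, hC i, hC' i, map_sub]

variable [NormedSpace ℝ H]

/-- All derivatives up to order three exist. -/
structure Diff3 (U : Fin 3 → ℝ → H →ₗᵢ[ℂ] H) (f : H) : Prop where
  one : ∀ i, Diff U i f
  two : ∀ i j, Diff U i (D U j f)
  three : ∀ i j k, Diff U i (D U j (D U k f))

variable {U : Fin 3 → ℝ → H →ₗᵢ[ℂ] H} {e : H} {C : H →L[ℂ] H} {f g : H}
  {ξ ζ η : PiLp 2 fun _ : Fin 3 => H}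

theorem Diff3.D_D_sub (hf : Diff3 U f) (hg : Diff3 U g) (i j : Fin 3) :
    D U i (D U j (f - g)) = D U i (D U j f) - D U i (D U j g) := by
  rw [D_sub (hf.one j) (hg.one j), D_sub (hf.two i j) (hg.two i j)]

theorem Diff3.sub (hf : Diff3 U f) (hg : Diff3 U g) : Diff3 U (f - g) where
  one i := (hf.one i).sub (hg.one i)
  two i j := by
    rw [D_sub (hf.one j) (hg.one j)]
    exact (hf.two i j).sub (hg.two i j)
  three i j k := by
    rw [hf.D_D_sub hg]
    exact (hf.three i j k).sub (hg.three i j k)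

variable [IsScalarTower ℝ ℂ H] [CompleteSpace H]

/-- One derivative falls on `f`; each mollification supplies one more. -/
theorem Diff3.mollify (hU : IsCommutingFlow U) (n : ℕ) (hf : ∀ i, Diff U i f) :
    Diff3 U (mollify U hU n (mollify U hU n f)) := by
  have hd := fun i g => diff_mollify hU i n g
  refine ⟨fun i => hd i _, fun i j => ?_, fun i j k => ?_⟩
  · rw [D_mollify hU n (hd j f)]
    exact hd i _
  · rw [D_mollify hU n (hd k f), D_mollify hU n (hf k), D_mollify hU n (hd j _)]
    exact hd i _

/-- Two integrations by parts carry `D i` to one side and `D j` to the other. Third derivatives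
occur in between, hence `Diff3`. -/
theorem Diff3.sum_inner_D_D (hU : IsCommutingFlow U) (hf : Diff3 U f) :
    ∑ i, ∑ j, ⟪D U i (D U j f), D U i (D U j f)⟫_ℂ =
      ⟪∑ j, D U j (D U j f), ∑ i, D U i (D U i f)⟫_ℂ := by
  simp only [sum_inner, inner_sum]
  refine Finset.sum_congr rfl fun i _ => Finset.sum_congr rfl fun j _ => ?_
  rw [inner_D hU (hf.two i j) (hf.three i i j),
    D_comm hU (hf.one i) (hf.one j) (hf.two i j) (hf.two j i),
    D_comm hU (hf.two i i) (hf.two j i) (hf.three i j i) (hf.three j i i)]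
  exact (inner_D hU (hf.two j j) (hf.three j i i)).symm

theorem Diff3.norm_le (hU : IsCommutingFlow U) (hf : Diff3 U f) (i j : Fin 3) :
    ‖D U i (D U j f)‖ ≤ ‖∑ j, D U j (D U j f)‖ := by
  have h := congrArg Complex.re (hf.sum_inner_D_D hU)
  simp only [Complex.re_sum] at h
  have hn : ∀ x : H, (⟪x, x⟫_ℂ).re = ‖x‖ ^ 2 := fun x => inner_self_eq_norm_sq (𝕜 := ℂ) x
  simp only [hn] at h
  have h1 := Finset.single_le_sum (f := fun j => ‖D U i (D U j f)‖ ^ 2)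
    (fun j _ => sq_nonneg _) (Finset.mem_univ j)
  have h2 := Finset.single_le_sum (f := fun i => ∑ j, ‖D U i (D U j f)‖ ^ 2)
    (fun i _ => Finset.sum_nonneg fun j _ => sq_nonneg _) (Finset.mem_univ i)
  exact (pow_le_pow_iff_left₀ (norm_nonneg _) (norm_nonneg _) two_ne_zero).1
    ((h1.trans h2).trans_eq h)

/-- This is `∇×∇× = ∇(∇·) - Δ`, with the gradient term zero. -/
theorem InH2.rot_rot (hU : IsCommutingFlow U) (hξ : InH2 U e ξ) (hdv : dv U ξ = 0) (k : Fin 3) :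
    rot U (rot U ξ) k = -∑ j, D U j (D U j (ξ k)) := by
  have h : D U k (dv U ξ) = 0 := by rw [hdv, D_zero]
  have h2 := hξ.2
  have hc : ∀ i j k, D U i (D U j (ξ k)) = D U j (D U i (ξ k)) := fun i j k =>
    D_comm hU (hξ.1.diff _ _) (hξ.1.diff _ _) (h2 _ _ _) (h2 _ _ _)
  simp only [dv, Fin.sum_univ_three] at h
  rw [D_add ((h2 _ _ _).add (h2 _ _ _)) (h2 _ _ _), D_add (h2 _ _ _) (h2 _ _ _)] at h
  rw [← sub_eq_zero, ← h]
  fin_cases k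
  · simp only [Fin.zero_eta, rot_zero, rot_one, rot_two, Fin.sum_univ_three,
      D_sub (h2 _ _ _) (h2 _ _ _)]
    rw [hc 1 0, hc 2 0]
    abel
  · simp only [Fin.mk_one, rot_zero, rot_one, rot_two, Fin.sum_univ_three,
      D_sub (h2 _ _ _) (h2 _ _ _)]
    rw [hc 0 1, hc 2 1]
    abel
  · simp only [Fin.reduceFinMk, rot_zero, rot_one, rot_two, Fin.sum_univ_three,
      D_sub (h2 _ _ _) (h2 _ _ _)]
    rw [hc 0 2, hc 1 2]
    abel

/-- A divergence-free field whose curl is differentiable has second derivatives. -/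
theorem InH1.inH2 (hU : IsErgodicFlow U e) (hη : InH1 U e η) (hrot : InH1 U e (rot U η))
    (hdv : dv U η = 0) : InH2 U e η := by
  refine ⟨hη, fun i j k => ?_⟩
  have hU' := hU.toIsCommutingFlow
  -- Two mollifications, so that `S n (η k)` has the three derivatives required by `Diff3.norm_le`.
  set S : ℕ → H →L[ℂ] H := fun n => mollify U hU' n ∘L mollify U hU' n with hS
  have hSc : ∀ n, Commutes U (S n) := fun n => (Commutes.mollify hU' n).comp (.mollify hU' n)
  have hSt : ∀ f, Tendsto (fun n => S n f) atTop (𝓝 f) := fun f =>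
    tendsto_mollify_of_tendsto hU' (tendsto_mollify hU' f)
  have h3 : ∀ n l, Diff3 U (S n (η l)) := fun n l => Diff3.mollify hU' n fun i => hη.diff i l
  -- `S n - S m` commutes with curl and divergence, so `(S n - S m) η` is divergence-free and its
  -- Laplacian is `-(S n - S m)(∇×∇×η)`, which controls all its second derivatives.
  have est : ∀ n m, ‖D U i (D U j (S n (η k))) - D U i (D U j (S m (η k)))‖ ≤
      ‖S n (rot U (rot U η) k) - S m (rot U (rot U η) k)‖ := by
    intro n m
    have hC := (hSc n).sub (hSc m)
    have h3' : ∀ l, Diff3 U (lift (S n - S m) η l) := fun l => (h3 n l).sub (h3 m l)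
    have h2 : InH2 U e (lift (S n - S m) η) := ⟨hη.map hU hC, fun i j l => (h3' l).two i j⟩
    have hr := h2.rot_rot hU' (by rw [dv_lift hC hη, hdv, _root_.map_zero]) k
    rw [rot_lift hC hη, rot_lift hC hrot] at hr
    have hle := (h3' k).norm_le hU' i j
    rw [← norm_neg (∑ j, _), ← hr] at hle
    rw [← (h3 n k).D_D_sub (h3 m k)]
    exact hle
  have hc : CauchySeq fun n => D U i (D U j (S n (η k))) := by
    have h0 := (hSt (rot U (rot U η) k)).cauchySeq
    rw [Metric.cauchySeq_iff] at h0 ⊢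
    intro ε hε
    obtain ⟨N, hN⟩ := h0 ε hε
    refine ⟨N, fun m hm n hn => lt_of_le_of_lt ?_ (hN m hm n hn)⟩
    rw [dist_eq_norm, dist_eq_norm]
    exact est m n
  obtain ⟨g, hg⟩ := cauchySeq_tendsto_of_complete hc
  refine (hasDerivAt_of_tendsto hU' (u := fun n => D U j (S n (η k))) (fun n => (h3 n k).two i j)
    ?_ hg).differentiableAt
  refine (hSt (D U j (η k))).congr fun n => ?_
  exact ((hSc n).D_apply (hη.diff j k)).symm

/-! ### Projection onto the closure of the curls -/

section Projection

variable {R : Submodule ℂ (PiLp 2 fun _ : Fin 3 => H)}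

theorem meanZero_of_mem_closure (hU : IsErgodicFlow U e)
    (hR : ∀ ζ, ζ ∈ R ↔ ∃ ξ, InH1 U e ξ ∧ rot U ξ = ζ) (h : ζ ∈ R.topologicalClosure) :
    MeanZero e ζ := by
  refine closure_minimal (s := (R : Set (PiLp 2 fun _ : Fin 3 => H))) ?_ (isClosed_meanZero e) h
  intro x hx
  obtain ⟨ξ, hξ, rfl⟩ := (hR x).1 hx
  exact meanZero_rot hU hξ

theorem lift_mem_closure (hU : IsErgodicFlow U e)
    (hR : ∀ ζ, ζ ∈ R ↔ ∃ ξ, InH1 U e ξ ∧ rot U ξ = ζ) (hC : Commutes U C)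
    (h : ζ ∈ R.topologicalClosure) : lift C ζ ∈ R.topologicalClosure := by
  refine map_mem_closure (lift C).continuous h fun x hx => ?_
  obtain ⟨ξ, hξ, rfl⟩ := (hR x).1 hx
  exact (hR _).2 ⟨lift C ξ, hξ.map hU hC, rot_lift hC hξ⟩

/-- The closed subspace is invariant under `lift C` and under its adjoint, so it reduces `lift C`.
-/
theorem starProjection_lift (hU : IsErgodicFlow U e)
    (hR : ∀ ζ, ζ ∈ R ↔ ∃ ξ, InH1 U e ξ ∧ rot U ξ = ζ) (hC : Commutes U C)
    (ξ : PiLp 2 fun _ : Fin 3 => H) :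
    R.topologicalClosure.starProjection (lift C ξ) =
      lift C (R.topologicalClosure.starProjection ξ) := by
  refine Submodule.eq_starProjection_of_mem_of_inner_eq_zero
    (lift_mem_closure hU hR hC (Submodule.starProjection_apply_mem _ _)) fun w hw => ?_
  rw [← map_sub, inner_lift]
  exact Submodule.starProjection_inner_eq_zero _ _
    (lift_mem_closure hU hR (hC.adjoint hU.toIsCommutingFlow) hw)

/-- By `starProjection_lift` the orbit of the projection is the projection of the orbit, and a
bounded operator preserves differentiability. -/
theorem InH1.starProjection (hU : IsErgodicFlow U e)
    (hR : ∀ ζ, ζ ∈ R ↔ ∃ ξ, InH1 U e ξ ∧ rot U ξ = ζ) (hξ : InH1 U e ξ) :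
    InH1 U e (R.topologicalClosure.starProjection ξ) := by
  refine fun k => ⟨fun i => ?_, meanZero_of_mem_closure hU hR
    (Submodule.starProjection_apply_mem _ _) k⟩
  have h : DifferentiableAt ℝ
      (fun t : ℝ => lift (U i t).toContinuousLinearMap ξ) 0 :=
    (differentiableAt_piLp 2).2 fun l => hξ.diff i l
  have h1 := ((R.topologicalClosure.starProjection.restrictScalars ℝ).differentiableAt).comp
    (0 : ℝ) h
  refine ((differentiableAt_piLp 2).1 h1 k).congr_of_eventuallyEq (Eventually.of_forall fun t => ?_)
  exact congrArg (fun x : PiLp 2 fun _ : Fin 3 => H => x k)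
    (starProjection_lift hU hR (Commutes.flow hU.toIsCommutingFlow i t) ξ).symm

/-- The removed part is orthogonal to all curls, so it contributes nothing to the weak curl. -/
theorem rot_starProjection (hU : IsErgodicFlow U e)
    (hR : ∀ ζ, ζ ∈ R ↔ ∃ ξ, InH1 U e ξ ∧ rot U ξ = ζ) (hξ : InH1 U e ξ) :
    rot U (R.topologicalClosure.starProjection ξ) = rot U ξ := by
  refine rot_eq_of_inner hU (hξ.starProjection hU hR) (meanZero_rot hU hξ) fun φ hφ => ?_
  rw [← inner_rot hU hφ hξ, ← sub_eq_zero, ← inner_sub_right, inner_eq_zero_symm,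
    ← neg_sub, inner_neg_left, Submodule.starProjection_inner_eq_zero, neg_zero]
  exact R.le_topologicalClosure ((hR _).2 ⟨φ, hφ, rfl⟩)

/-- By parts, the pairing is minus that of `η` with the gradient of a twice differentiable `φ`.
Gradients are curl-free, hence orthogonal to curls and to their limits. -/
theorem inner_dv_mollify (hU : IsErgodicFlow U e)
    (hR : ∀ ζ, ζ ∈ R ↔ ∃ ξ, InH1 U e ξ ∧ rot U ξ = ζ) (hη : InH1 U e η)
    (h : η ∈ R.topologicalClosure) (n : ℕ) (f : H) :
    ⟪dv U η, mollify U hU.toIsCommutingFlow n (mollify U hU.toIsCommutingFlow n f)⟫_ℂ = 0 := by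
  have hU' := hU.toIsCommutingFlow
  set φ := mollify U hU' n (mollify U hU' n f) with hφ
  have hφ1 : ∀ i, Diff U i φ := fun i => diff_mollify hU' i n _
  have hφ2 : ∀ i j, Diff U i (D U j φ) := by
    intro i j
    rw [hφ, D_mollify hU' n (diff_mollify hU' j n f)]
    exact diff_mollify hU' i n _
  set γ : PiLp 2 fun _ : Fin 3 => H := WithLp.toLp 2 fun j => D U j φ with hγ
  have hγ1 : InH1 U e γ := fun k => ⟨fun i => hφ2 i k, inner_D_eq_zero hU (hφ1 k)⟩
  have hrot : rot U γ = 0 := by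
    have hc : ∀ i j, D U i (γ j) = D U j (γ i) := fun i j =>
      D_comm hU' (hφ1 i) (hφ1 j) (hφ2 i j) (hφ2 j i)
    refine ext_fin_three ?_ ?_ ?_
    exacts [sub_eq_zero.2 (hc 1 2), sub_eq_zero.2 (hc 2 0), sub_eq_zero.2 (hc 0 1)]
  have h1 : ⟪dv U η, φ⟫_ℂ = -⟪η, γ⟫_ℂ := by
    simp only [dv, sum_inner, PiLp.inner_apply, inner_D hU' (hη.diff _ _) (hφ1 _),
      Finset.sum_neg_distrib]
    rfl
  rw [h1, neg_eq_zero]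
  refine closure_minimal (s := (R : Set (PiLp 2 fun _ : Fin 3 => H)))
    (t := {x | ⟪x, γ⟫_ℂ = 0}) ?_ (isClosed_eq (continuous_id.inner continuous_const)
      continuous_const) h
  intro x hx
  obtain ⟨ξ, hξ, rfl⟩ := (hR x).1 hx
  change ⟪rot U ξ, γ⟫_ℂ = 0
  rw [inner_rot hU hξ hγ1, hrot, inner_zero_right]

theorem dv_eq_zero (hU : IsErgodicFlow U e)
    (hR : ∀ ζ, ζ ∈ R ↔ ∃ ξ, InH1 U e ξ ∧ rot U ξ = ζ) (hη : InH1 U e η)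
    (h : η ∈ R.topologicalClosure) : dv U η = 0 := by
  have hU' := hU.toIsCommutingFlow
  have h1 := (tendsto_const_nhds (x := dv U η)).inner (𝕜 := ℂ)
    (tendsto_mollify_of_tendsto hU' (tendsto_mollify hU' (dv U η)))
  simp only [inner_dv_mollify hU hR hη h] at h1
  exact inner_self_eq_zero.1 (tendsto_nhds_unique h1 tendsto_const_nhds)

/-- Every differentiable curl is the curl of a divergence-free field with second derivatives. -/
theorem exists_inH2 (hU : IsErgodicFlow U e)
    (hR : ∀ ζ, ζ ∈ R ↔ ∃ ξ, InH1 U e ξ ∧ rot U ξ = ζ) (hζ : InH1 U e ζ) (h : ζ ∈ R) :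
    ∃ η, InH2 U e η ∧ dv U η = 0 ∧ rot U η = ζ := by
  obtain ⟨ξ, hξ, rfl⟩ := (hR ζ).1 h
  have h1 := hξ.starProjection hU hR
  -- A change of gauge: the projected potential has the same curl and zero divergence, so
  -- `InH1.inH2` applies to it.
  have h2 := rot_starProjection hU hR hξ
  have h3 := dv_eq_zero hU hR h1 (Submodule.starProjection_apply_mem _ _)
  exact ⟨_, h1.inH2 hU (h2 ▸ hζ) h3, h3, h2⟩

/-- Differentiable curls together with differentiable curl-free fields span a dense set of fields
of mean zero. -/
theorem mem_closure_of_meanZero (hU : IsErgodicFlow U e)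
    (hR : ∀ ζ, ζ ∈ R ↔ ∃ ξ, InH1 U e ξ ∧ rot U ξ = ζ)
    {W : Submodule ℂ (PiLp 2 fun _ : Fin 3 => H)} (hW1 : ∀ ζ ∈ R, InH1 U e ζ → ζ ∈ W)
    (hW2 : ∀ ξ, InH1 U e ξ → rot U ξ = 0 → ξ ∈ W) (hξ : MeanZero e ξ) :
    ξ ∈ W.topologicalClosure := by
  have hU' := hU.toIsCommutingFlow
  have hK : R.topologicalClosure ≤ W.topologicalClosure := by
    refine R.topologicalClosure_minimal ?_ W.isClosed_topologicalClosure
    intro x hx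
    obtain ⟨φ, hφ, rfl⟩ := (hR x).1 hx
    refine mem_closure_of_tendsto (tendsto_lift_mollify hU' (rot U φ))
      (Eventually.of_forall fun n => ?_)
    have hS := Commutes.mollify hU' n
    refine hW1 _ ((hR _).2 ⟨_, hφ.map hU hS, rot_lift hS hφ⟩) ?_
    exact inH1_mollify hU n (meanZero_rot hU hφ)
  have hp := Submodule.starProjection_apply_mem R.topologicalClosure ξ
  -- The remainder is orthogonal to all curls, so its weak curl is zero and its mollifications are
  -- curl-free fields of `InH1`.
  rw [← add_sub_cancel (R.topologicalClosure.starProjection ξ) ξ]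
  refine add_mem (hK hp) ?_
  have hd : MeanZero e (ξ - R.topologicalClosure.starProjection ξ) :=
    hξ.sub (meanZero_of_mem_closure hU hR hp)
  refine mem_closure_of_tendsto (tendsto_lift_mollify hU' _) (Eventually.of_forall fun n => ?_)
  refine hW2 _ (inH1_mollify hU n hd) ?_
  rw [rot_mollify hU n hd (η := 0) (fun k => inner_zero_right _), _root_.map_zero]
  intro φ hφ
  rw [inner_zero_right, inner_eq_zero_symm, Submodule.starProjection_inner_eq_zero]
  exact R.le_topologicalClosure ((hR _).2 ⟨φ, hφ, rfl⟩)

end Projection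

end Flow

/-! ### Graphs of composites, restrictions and inverses -/

theorem LinearPMap.mem_graph_naturalComp {E F G : Type*} [AddCommGroup E] [Module ℂ E]
    [AddCommGroup F] [Module ℂ F] [AddCommGroup G] [Module ℂ G] (g : F →ₗ.[ℂ] G)
    (f : E →ₗ.[ℂ] F) {x : E} {z : G} :
    (x, z) ∈ (g.naturalComp f).graph ↔ ∃ y, (x, y) ∈ f.graph ∧ (y, z) ∈ g.graph := by
  have hval : ∀ (w : (g.naturalComp f).domain) (hw : (w : E) ∈ f.domain)
      (hfw : f ⟨w, hw⟩ ∈ g.domain), g.naturalComp f w = g ⟨f ⟨w, hw⟩, hfw⟩ := by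
    intro w hw hfw
    change g ⟨f.domRestrict _ w, _⟩ = _
    congr 2
  constructor
  · intro h
    obtain ⟨w, rfl, rfl⟩ := (LinearPMap.mem_graph_iff _).1 h
    obtain ⟨⟨v, hv, hvw⟩, hw⟩ := w.2
    have hfw : f ⟨w, hw⟩ ∈ g.domain := by
      have : v = ⟨w, hw⟩ := Subtype.ext hvw
      exact this ▸ hv
    exact ⟨f ⟨w, hw⟩, f.mem_graph ⟨w, hw⟩, by rw [hval w hw hfw]; exact g.mem_graph ⟨_, hfw⟩⟩
  · rintro ⟨y, h1, h2⟩
    obtain ⟨v, rfl, rfl⟩ := (LinearPMap.mem_graph_iff _).1 h1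
    obtain ⟨u, hu, rfl⟩ := (LinearPMap.mem_graph_iff _).1 h2
    have hfv : f v ∈ g.domain := by
      have h3 := u.2
      rwa [hu] at h3
    have hw : (v : E) ∈ (g.naturalComp f).domain := ⟨⟨v, hfv, rfl⟩, v.2⟩
    refine (LinearPMap.mem_graph_iff _).2 ⟨⟨v, hw⟩, rfl, ?_⟩
    rw [hval ⟨v, hw⟩ v.2 hfv]
    congr 1
    exact Subtype.ext hu.symm

theorem LinearPMap.mem_graph_domRestrict {E F : Type*} [AddCommGroup E] [Module ℂ E]
    [AddCommGroup F] [Module ℂ F] (f : E →ₗ.[ℂ] F) (S : Submodule ℂ E) {x : E} {y : F} :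
    (x, y) ∈ (f.domRestrict S).graph ↔ x ∈ S ∧ (x, y) ∈ f.graph := by
  constructor
  · intro h
    obtain ⟨w, rfl, rfl⟩ := (LinearPMap.mem_graph_iff _).1 h
    refine ⟨w.2.1, (LinearPMap.mem_graph_iff _).2 ⟨⟨w, w.2.2⟩, rfl, ?_⟩⟩
    exact (LinearPMap.domRestrict_apply rfl).symm
  · rintro ⟨hx, h⟩
    obtain ⟨w, rfl, rfl⟩ := (LinearPMap.mem_graph_iff _).1 h
    exact (LinearPMap.mem_graph_iff _).2 ⟨⟨w, hx, w.2⟩, rfl, LinearPMap.domRestrict_apply rfl⟩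

theorem LinearPMap.mem_graph_inverse {E F : Type*} [AddCommGroup E] [Module ℂ E]
    [AddCommGroup F] [Module ℂ F] {f : E →ₗ.[ℂ] F} (hf : LinearMap.ker f.toFun = ⊥)
    {x : E} {y : F} : (y, x) ∈ f.inverse.graph ↔ (x, y) ∈ f.graph := by
  rw [LinearPMap.inverse_graph hf, Submodule.mem_map]
  constructor
  · rintro ⟨⟨a, b⟩, h, hab⟩
    simp only [LinearEquiv.coe_coe, LinearEquiv.prodComm_apply, Prod.swap_prod_mk,
      Prod.mk.injEq] at hab
    exact hab.1 ▸ hab.2 ▸ h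
  · exact fun h => ⟨(x, y), h, rfl⟩

theorem LinearPMap.mem_range_iff_graph {E F : Type*} [AddCommGroup E] [Module ℂ E]
    [AddCommGroup F] [Module ℂ F] {f : E →ₗ.[ℂ] F} {y : F} :
    y ∈ LinearMap.range f.toFun ↔ ∃ x, (x, y) ∈ f.graph := by
  constructor
  · rintro ⟨x, rfl⟩
    exact ⟨x, f.mem_graph x⟩
  · rintro ⟨x, h⟩
    obtain ⟨w, -, hw⟩ := (LinearPMap.mem_graph_iff _).1 h
    exact ⟨w, hw⟩

/-! ### The translation flow and its ergodicity -/

namespace StationaryField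

variable {Ω : Type*} [MeasurableSpace Ω] (P : Measure Ω) [IsProbabilityMeasure P]
  [AddAction (Fin 3 → ℝ) Ω] [MeasurableConstVAdd (Fin 3 → ℝ) Ω]

section Flow

variable [VAddInvariantMeasure (Fin 3 → ℝ) Ω P]

theorem translation_translation (x y : Fin 3 → ℝ) (f : ScalarL2 P) :
    translation P x (translation P y f) = translation P (x + y) f := by
  have h := Lp.compMeasurePreserving_comp_apply (p := 2) f (measurePreserving_vadd (-y) P)
    (measurePreserving_vadd (-x) P)
  refine Eq.trans h.symm ?_
  have h1 : (fun ω : Ω => -y +ᵥ ω) ∘ (fun ω : Ω => -x +ᵥ ω) = fun ω : Ω => -(x + y) +ᵥ ω := by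
    funext ω
    simp only [Function.comp_apply, vadd_vadd]
    congr 1
    abel
  change Lp.compMeasurePreserving _ _ f = Lp.compMeasurePreserving _ _ f
  congr 2

/-- `T_0` is idempotent by the group law and injective as an isometry. -/
theorem translation_zero (f : ScalarL2 P) : translation P 0 f = f := by
  apply (translation P 0).injective
  rw [translation_translation, add_zero]

theorem coeFn_translation (x : Fin 3 → ℝ) (f : ScalarL2 P) :
    translation P x f =ᵐ[P] fun ω => f (-x +ᵥ ω) :=
  Lp.coeFn_compMeasurePreserving f (measurePreserving_vadd (-x) P)

/-- The translations along the three coordinate axes. -/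
def flow (i : Fin 3) (t : ℝ) : ScalarL2 P →ₗᵢ[ℂ] ScalarL2 P :=
  translation P (Pi.single i t)

theorem isCommutingFlow_flow (hT : ∀ f : ScalarL2 P, Continuous fun x => translation P x f) :
    IsCommutingFlow (flow P) where
  zero i f := by rw [flow, Pi.single_zero, translation_zero]
  add i s t f := by rw [flow, flow, flow, Pi.single_add, translation_translation]
  comm i j s t f := by
    rw [flow, flow, translation_translation, translation_translation, add_comm]
  cont i f := (hT f).comp (_root_.continuous_single (A := fun _ : Fin 3 => ℝ) i)

theorem translation_eq_of_flow {f : ScalarL2 P} (hf : ∀ i t, flow P i t f = f)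
    (x : Fin 3 → ℝ) : translation P x f = f := by
  have hx : x = Pi.single 0 (x 0) + (Pi.single 1 (x 1) + Pi.single 2 (x 2)) := by
    funext i
    fin_cases i <;> simp
  rw [hx, ← translation_translation, ← translation_translation]
  exact ((congrArg _ ((congrArg _ (hf 2 _)).trans (hf 1 _))).trans (hf 0 _))

end Flow

/-- The constant field `1`. -/
def one : ScalarL2 P := Lp.const 2 P (1 : ℂ)

theorem coeFn_one : one P =ᵐ[P] fun _ => (1 : ℂ) :=
  Lp.coeFn_const (p := 2) (μ := P) (1 : ℂ)

theorem inner_one (f : ScalarL2 P) : ⟪one P, f⟫_ℂ = ∫ ω, f ω ∂P := by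
  rw [L2.inner_def]
  refine integral_congr_ae ?_
  filter_upwards [coeFn_one P] with ω h
  rw [h]
  simp

/-- Every preimage of a measurable set is almost invariant, hence null or conull by ergodicity; such
a function is almost everywhere constant. -/
theorem ae_const_of_translation_eq [ErgodicVAdd (Fin 3 → ℝ) Ω P] {f : ScalarL2 P}
    (hf : ∀ x, translation P x f = f) : ∃ c : ℂ, f =ᵐ[P] Function.const Ω c := by
  refine exists_eventuallyEq_const_of_forall_separating MeasurableSet fun s hs => ?_
  have hm : MeasurableSet (f ⁻¹' s) := (Lp.stronglyMeasurable f).measurable hs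
  have h := ErgodicVAdd.aeconst_of_forall_preimage_vadd_ae_eq (G := Fin 3 → ℝ) (μ := P) hm
    fun g => by
      have h1 := coeFn_translation P (-g) f
      rw [hf, neg_neg] at h1
      filter_upwards [h1] with ω hω
      refine propext ?_
      change f (g +ᵥ ω) ∈ s ↔ f ω ∈ s
      rw [hω]
  exact eventuallyConst_set.1 h

theorem isErgodicFlow_flow [ErgodicVAdd (Fin 3 → ℝ) Ω P]
    (hT : ∀ f : ScalarL2 P, Continuous fun x => translation P x f) :
    IsErgodicFlow (flow P) (one P) where
  toIsCommutingFlow := isCommutingFlow_flow P hT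
  fixed i t := by
    refine Lp.ext ?_
    have h1 := coeFn_one P
    filter_upwards [coeFn_translation P (Pi.single i t) (one P), h1,
      (measurePreserving_vadd (-(Pi.single i t : Fin 3 → ℝ)) P).quasiMeasurePreserving.ae h1]
      with ω h h2 h3
    rw [flow, h, h2, h3]
  norm_eq_one := by
    have h := inner_self_eq_norm_sq (𝕜 := ℂ) (one P)
    rw [inner_one, integral_congr_ae (coeFn_one P)] at h
    have h1 : ‖one P‖ ^ 2 = 1 := by rw [← h]; simp
    exact (pow_eq_one_iff_of_nonneg (norm_nonneg _) two_ne_zero).1 h1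
  eq_zero f hf h0 := by
    obtain ⟨c, hc⟩ := ae_const_of_translation_eq P (translation_eq_of_flow P hf)
    rw [inner_one, integral_congr_ae hc] at h0
    have hc0 : c = 0 := by simpa using h0
    refine Lp.ext (hc.trans ?_)
    rw [hc0]
    exact (Lp.coeFn_zero ℂ 2 P).symm

/-! ### The concrete operators in terms of the abstract flow -/

section Bridge

variable [VAddInvariantMeasure (Fin 3 → ℝ) Ω P]

theorem mem_graph_generator {i : Fin 3} {f g : ScalarL2 P} :
    (f, g) ∈ (generator P i).graph ↔ Flow.Diff (flow P) i f ∧ Flow.D (flow P) i f = g := by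
  constructor
  · intro h
    obtain ⟨w, rfl, rfl⟩ := (LinearPMap.mem_graph_iff _).1 h
    exact ⟨w.2, rfl⟩
  · rintro ⟨h, rfl⟩
    exact (generator P i).mem_graph ⟨f, h⟩

theorem mem_H1 {ξ : VectorL2 P} : ξ ∈ H1 P ↔ Flow.InH1 (flow P) (one P) ξ := by
  refine forall_congr' fun k => ?_
  rw [inner_one]
  exact Iff.rfl

theorem mem_H2 {ξ : VectorL2 P} : ξ ∈ H2 P ↔ Flow.InH2 (flow P) (one P) ξ := by
  have h : ∀ (i j : Fin 3) (f : ScalarL2 P), Flow.Diff (flow P) j f →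
      (f ∈ ((generator P i).naturalComp (generator P j)).domain ↔
        Flow.Diff (flow P) i (Flow.D (flow P) j f)) := by
    intro i j f hf
    rw [LinearPMap.mem_domain_iff]
    simp only [LinearPMap.mem_graph_naturalComp, mem_graph_generator]
    constructor
    · rintro ⟨_, _, ⟨_, rfl⟩, h, _⟩
      exact h
    · exact fun h => ⟨_, _, ⟨hf, rfl⟩, h, rfl⟩
  have h2 : ξ ∈ H2 P ↔ ξ ∈ H1 P ∧
      ∀ k i j, ξ k ∈ ((generator P i).naturalComp (generator P j)).domain := by
    change (∀ k, ξ k ∈ H2Scalar P) ↔ (∀ k, ξ k ∈ H1Scalar P) ∧ _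
    simp only [H2Scalar, Submodule.mem_inf, Submodule.mem_iInf, forall_and]
  rw [h2, mem_H1]
  refine and_congr_right fun h1 => ?_
  constructor
  · exact fun H i j k => (h i j _ (h1.diff j k)).1 (H k i j)
  · exact fun H k i j => (h i j _ (h1.diff j k)).2 (H i j k)

theorem curl_apply (ξ : (curl P).domain) : curl P ξ = Flow.rot (flow P) ξ :=
  Flow.ext_fin_three rfl rfl rfl

theorem mem_graph_curl {ξ ζ : VectorL2 P} : (ξ, ζ) ∈ (curl P).graph ↔
    Flow.InH1 (flow P) (one P) ξ ∧ Flow.rot (flow P) ξ = ζ := by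
  constructor
  · intro h
    obtain ⟨w, rfl, rfl⟩ := (LinearPMap.mem_graph_iff _).1 h
    exact ⟨(mem_H1 P).1 w.2, (curl_apply P w).symm⟩
  · rintro ⟨h, rfl⟩
    have := (curl P).mem_graph ⟨ξ, (mem_H1 P).2 h⟩
    rwa [curl_apply] at this

theorem mem_curlRange {ζ : VectorL2 P} : ζ ∈ curlRange P ↔
    ∃ ξ, Flow.InH1 (flow P) (one P) ξ ∧ Flow.rot (flow P) ξ = ζ := by
  rw [curlRange, LinearPMap.mem_range_iff_graph]
  simp only [mem_graph_curl]

theorem gradAdjoint_apply (ξ : H1 P) :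
    (gradAdjoint P).toFun ξ = -Flow.dv (flow P) (ξ : VectorL2 P) := by
  change (-∑ i, partialDeriv P i i : H1 P →ₗ[ℂ] ScalarL2 P) ξ = _
  rw [LinearMap.neg_apply, LinearMap.sum_apply]
  rfl

theorem mem_gradAdjointKernel {ξ : VectorL2 P} : ξ ∈ gradAdjointKernel P ↔
    Flow.InH1 (flow P) (one P) ξ ∧ Flow.dv (flow P) ξ = 0 := by
  rw [gradAdjointKernel, Submodule.mem_map, ← mem_H1]
  constructor
  · rintro ⟨y, hy, rfl⟩
    rw [LinearMap.mem_ker] at hy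
    exact ⟨y.2, neg_eq_zero.1 ((gradAdjoint_apply P y).symm.trans hy)⟩
  · rintro ⟨h, h0⟩
    refine ⟨⟨ξ, h⟩, ?_, rfl⟩
    rw [LinearMap.mem_ker]
    exact (gradAdjoint_apply P ⟨ξ, h⟩).trans (neg_eq_zero.2 h0)

end Bridge

/-! ### The composite `∇×(∇×∇×)⁻¹∇×` -/

variable [ErgodicVAdd (Fin 3 → ℝ) Ω P]

/-- For `η` in `H2` the curl lies in `H1`, including the mean-zero condition, so the second curl
imposes no further restriction on the domain. -/
theorem mem_graph_curlCurl (hT : ∀ f : ScalarL2 P, Continuous fun x => translation P x f)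
    {η ζ : VectorL2 P} : (η, ζ) ∈ (curlCurl P).graph ↔
      Flow.InH2 (flow P) (one P) η ∧ Flow.dv (flow P) η = 0 ∧
        Flow.rot (flow P) (Flow.rot (flow P) η) = ζ := by
  rw [curlCurl, LinearPMap.mem_graph_domRestrict, LinearPMap.mem_graph_naturalComp,
    Submodule.mem_inf, mem_H2, mem_gradAdjointKernel]
  simp only [mem_graph_curl]
  constructor
  · rintro ⟨⟨h2, -, h0⟩, _, ⟨-, rfl⟩, -, h⟩
    exact ⟨h2, h0, h⟩
  · rintro ⟨h2, h0, h⟩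
    exact ⟨⟨h2, h2.1, h0⟩, _, ⟨h2.1, rfl⟩,
      h2.inH1_rot (Flow.meanZero_rot (isErgodicFlow_flow P hT) h2.1), h⟩

theorem curlCurl_domain (hT : ∀ f : ScalarL2 P, Continuous fun x => translation P x f) :
    (curlCurl P).domain = H2 P ⊓ gradAdjointKernel P := by
  ext η
  rw [LinearPMap.mem_domain_iff, Submodule.mem_inf, mem_H2, mem_gradAdjointKernel]
  simp only [mem_graph_curlCurl P hT]
  constructor
  · rintro ⟨_, h2, h0, -⟩
    exact ⟨h2, h2.1, h0⟩
  · rintro ⟨h2, -, h0⟩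
    exact ⟨_, h2, h0, rfl⟩

theorem ker_curlCurl (hT : ∀ f : ScalarL2 P, Continuous fun x => translation P x f) :
    LinearMap.ker (curlCurl P).toFun = ⊥ := by
  rw [LinearMap.ker_eq_bot']
  intro η hη
  obtain ⟨h2, h0, h⟩ := (mem_graph_curlCurl P hT).1 ((curlCurl P).mem_graph η)
  exact Subtype.ext (h2.eq_zero (isErgodicFlow_flow P hT) h0 (h.trans hη))

theorem mem_graph_upsilonComposite
    (hT : ∀ f : ScalarL2 P, Continuous fun x => translation P x f) {ξ ζ : VectorL2 P} :
    (ξ, ζ) ∈ (upsilonComposite P).graph ↔ Flow.InH1 (flow P) (one P) ξ ∧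
      ∃ η, Flow.InH2 (flow P) (one P) η ∧ Flow.dv (flow P) η = 0 ∧
        Flow.rot (flow P) (Flow.rot (flow P) η) = Flow.rot (flow P) ξ ∧
        Flow.rot (flow P) η = ζ := by
  simp only [upsilonComposite, LinearPMap.mem_graph_naturalComp, mem_graph_curl,
    LinearPMap.mem_graph_inverse (ker_curlCurl P hT), mem_graph_curlCurl P hT]
  constructor
  · rintro ⟨η, ⟨_, ⟨h1, rfl⟩, h2, h0, h⟩, -, h3⟩
    exact ⟨h1, η, h2, h0, h, h3⟩
  · rintro ⟨h1, η, h2, h0, h, h3⟩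
    exact ⟨η, ⟨_, ⟨h1, rfl⟩, h2, h0, h⟩, h2.1, h3⟩

/-- With `∇×∇×η = ∇×ξ`, the difference `ξ - ∇×η` is curl-free; symmetry of the curl makes it
orthogonal to all curls. -/
theorem upsilonComposite_eq_starProjection
    (hT : ∀ f : ScalarL2 P, Continuous fun x => translation P x f) {ξ ζ : VectorL2 P}
    (h : (ξ, ζ) ∈ (upsilonComposite P).graph) :
    (curlRange P).topologicalClosure.starProjection ξ = ζ := by
  have hU := isErgodicFlow_flow P hT
  obtain ⟨h1, η, h2, h0, h3, rfl⟩ := (mem_graph_upsilonComposite P hT).1 h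
  have h4 := h2.inH1_rot (Flow.meanZero_rot hU h2.1)
  refine Submodule.eq_starProjection_of_mem_orthogonal
    ((curlRange P).le_topologicalClosure ((mem_curlRange P).2 ⟨η, h2.1, rfl⟩)) ?_
  rw [Submodule.orthogonal_closure, Submodule.mem_orthogonal]
  intro w hw
  obtain ⟨φ, hφ, rfl⟩ := (mem_curlRange P).1 hw
  rw [Flow.inner_rot hU hφ (h1.sub h4), Flow.rot_sub h1 h4, h3, sub_self, inner_zero_right]

/-- No second derivatives need be assumed: `exists_inH2` provides the potential of `ζ` on which
`∇×∇×` is defined. -/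
theorem mem_graph_upsilonComposite_of_mem
    (hT : ∀ f : ScalarL2 P, Continuous fun x => translation P x f) {ξ ζ : VectorL2 P}
    (hξ : ξ ∈ H1 P) (hζ : ζ ∈ curlRange P) (hζ1 : ζ ∈ H1 P)
    (h : Flow.rot (flow P) ζ = Flow.rot (flow P) ξ) :
    (ξ, ζ) ∈ (upsilonComposite P).graph := by
  obtain ⟨η, h2, h0, rfl⟩ := Flow.exists_inH2 (isErgodicFlow_flow P hT)
    (fun _ => mem_curlRange P) ((mem_H1 P).1 hζ1) hζ
  exact (mem_graph_upsilonComposite P hT).2 ⟨(mem_H1 P).1 hξ, η, h2, h0, h, rfl⟩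

theorem mem_H1Hilbert (hT : ∀ f : ScalarL2 P, Continuous fun x => translation P x f)
    {ξ : VectorL2 P} : ξ ∈ H1Hilbert P ↔ Flow.MeanZero (one P) ξ := by
  constructor
  · exact fun h => closure_minimal (fun x hx => ((mem_H1 P).1 hx).meanZero)
      (Flow.isClosed_meanZero _) h
  · exact fun h => mem_closure_of_tendsto
      (Flow.tendsto_lift_mollify (isCommutingFlow_flow P hT) ξ)
      (Eventually.of_forall fun n => (mem_H1 P).2
        (Flow.inH1_mollify (isErgodicFlow_flow P hT) n h))

theorem upsilonComposite_domain_le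
    (hT : ∀ f : ScalarL2 P, Continuous fun x => translation P x f) :
    (upsilonComposite P).domain ≤ H1 P := by
  intro ξ hξ
  obtain ⟨ζ, h⟩ := LinearPMap.mem_domain_iff.1 hξ
  exact (mem_H1 P).2 ((mem_graph_upsilonComposite P hT).1 h).1

theorem closure_upsilonComposite_domain
    (hT : ∀ f : ScalarL2 P, Continuous fun x => translation P x f) :
    (upsilonComposite P).domain.topologicalClosure = H1Hilbert P := by
  refine le_antisymm (Submodule.topologicalClosure_mono (upsilonComposite_domain_le P hT)) ?_
  intro ξ hξ
  refine Flow.mem_closure_of_meanZero (isErgodicFlow_flow P hT) (fun _ => mem_curlRange P)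
    (fun ζ hζ hζ1 => ?_) (fun φ hφ h0 => ?_) ((mem_H1Hilbert P hT).1 hξ)
  -- The composite fixes a curl in `H1`; in the other case it sends a curl-free field to `0`.
  · exact LinearPMap.mem_domain_iff.2 ⟨ζ, mem_graph_upsilonComposite_of_mem P hT
      ((mem_H1 P).2 hζ1) hζ ((mem_H1 P).2 hζ1) rfl⟩
  · refine LinearPMap.mem_domain_iff.2 ⟨0, mem_graph_upsilonComposite_of_mem P hT
      ((mem_H1 P).2 hφ) (zero_mem _) (zero_mem _) ?_⟩
    simpa only [sub_self, h0] using Flow.rot_sub hφ hφ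

theorem upsilonComposite_domain_eq
    (hT : ∀ f : ScalarL2 P, Continuous fun x => translation P x f)
    (hc : IsClosed (curlRange P : Set (VectorL2 P))) : (upsilonComposite P).domain = H1 P := by
  refine le_antisymm (upsilonComposite_domain_le P hT) fun ξ hξ => ?_
  have hU := isErgodicFlow_flow P hT
  have hR : ∀ ζ, ζ ∈ curlRange P ↔ _ := fun _ => mem_curlRange P
  have hp := Submodule.starProjection_apply_mem (curlRange P).topologicalClosure ξ
  replace hp := hc.submodule_topologicalClosure_eq.le hp
  exact LinearPMap.mem_domain_iff.2 ⟨_, mem_graph_upsilonComposite_of_mem P hT hξ hp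
    ((mem_H1 P).2 (((mem_H1 P).1 hξ).starProjection hU hR))
    (Flow.rot_starProjection hU hR ((mem_H1 P).1 hξ))⟩

theorem range_upsilonComposite
    (hT : ∀ f : ScalarL2 P, Continuous fun x => translation P x f) :
    LinearMap.range (upsilonComposite P).toFun = curlRange P ⊓ H1 P := by
  ext ζ
  rw [LinearPMap.mem_range_iff_graph, Submodule.mem_inf]
  constructor
  · rintro ⟨ξ, h⟩
    obtain ⟨h1, η, h2, h0, h3, rfl⟩ := (mem_graph_upsilonComposite P hT).1 h
    exact ⟨(mem_curlRange P).2 ⟨η, h2.1, rfl⟩, (mem_H1 P).2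
      (h2.inH1_rot (Flow.meanZero_rot (isErgodicFlow_flow P hT) h2.1))⟩
  · rintro ⟨h, h1⟩
    exact ⟨ζ, mem_graph_upsilonComposite_of_mem P hT h1 h h1 rfl⟩

theorem closure_curlRange_le
    (hT : ∀ f : ScalarL2 P, Continuous fun x => translation P x f) :
    (curlRange P).topologicalClosure ≤ H1Hilbert P :=
  fun _ h => (mem_H1Hilbert P hT).2
    (Flow.meanZero_of_mem_closure (isErgodicFlow_flow P hT) (fun _ => mem_curlRange P) h)

theorem curl_adjoint_iff (hT : ∀ f : ScalarL2 P, Continuous fun x => translation P x f)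
    {ζ η : VectorL2 P} (hζ : ζ ∈ H1Hilbert P) (hη : η ∈ H1Hilbert P) :
    (∀ ξ : (curl P).domain, ⟪curl P ξ, ζ⟫_ℂ = ⟪(ξ : VectorL2 P), η⟫_ℂ) ↔
      (ζ, η) ∈ (curl P).graph.topologicalClosure := by
  have h := Flow.adjoint_rot_iff (isErgodicFlow_flow P hT) ((mem_H1Hilbert P hT).1 hζ)
    ((mem_H1Hilbert P hT).1 hη)
  have hs : ((curl P).graph : Set (VectorL2 P × VectorL2 P)) =
      {p | Flow.InH1 (flow P) (one P) p.1 ∧ Flow.rot (flow P) p.1 = p.2} := by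
    ext ⟨a, b⟩
    exact mem_graph_curl P
  rw [← hs] at h
  refine Iff.trans ?_ h
  constructor
  · intro H φ hφ
    have := H ⟨φ, (mem_H1 P).2 hφ⟩
    rwa [curl_apply] at this
  · intro H ξ
    rw [curl_apply]
    exact H ξ ((mem_H1 P).1 ξ.2)

end StationaryField

/-! ### Compressions of one orthogonal projection by another -/

section Spectrum

variable {E : Type*} [NormedAddCommGroup E] [InnerProductSpace ℂ E] [CompleteSpace E]

theorem isSelfAdjoint_comp_comp {X Q : E →L[ℂ] E} (hX : IsSelfAdjoint X) (hQ : IsSelfAdjoint Q) :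
    IsSelfAdjoint (X ∘L Q ∘L X) := by
  have h := hQ.conjugate_self hX
  rwa [mul_assoc] at h

open scoped ComplexOrder in
-- Positivity of `Q` passes to `X Q X` and makes the spectrum real and nonnegative; the norm bound 1
-- gives the upper end.
theorem spectrum_comp_comp_subset {X Q : E →L[ℂ] E} (hX : IsStarProjection X)
    (hQ : IsStarProjection Q) : spectrum ℂ (X ∘L Q ∘L X) ⊆ Complex.ofReal '' Set.Icc 0 1 := by
  intro z hz
  have hpos : (0 : E →L[ℂ] E) ≤ X ∘L Q ∘L X := by
    rw [ContinuousLinearMap.nonneg_iff_isPositive]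
    have h := (ContinuousLinearMap.IsPositive.of_isStarProjection hQ).adjoint_conj X
    rwa [hX.isSelfAdjoint.adjoint_eq] at h
  have hz0 : 0 ≤ z := spectrum_nonneg_of_nonneg hpos hz
  have hre : ((z.re : ℝ) : ℂ) = z := (Complex.eq_re_of_ofReal_le hz0).symm
  have hnorm : ‖X ∘L Q ∘L X‖ ≤ 1 := by
    calc ‖X ∘L Q ∘L X‖ ≤ ‖X‖ * (‖Q‖ * ‖X‖) :=
          (ContinuousLinearMap.opNorm_comp_le _ _).trans (by
            gcongr; exact ContinuousLinearMap.opNorm_comp_le _ _)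
      _ ≤ 1 * (1 * 1) := by
          have := hX.norm_le
          have := hQ.norm_le
          gcongr
      _ = 1 := by norm_num
  -- Only `‖1‖ ≤ 1` is used, so the zero space needs no separate case.
  have hz1 : ‖z‖ ≤ 1 := (spectrum.norm_le_norm_mul_of_mem hz).trans
    (mul_le_one₀ hnorm (norm_nonneg _) ContinuousLinearMap.norm_id_le)
  refine ⟨z.re, ⟨(Complex.le_def.1 hz0).1, ?_⟩, hre⟩
  exact ((le_abs_self _).trans (Complex.abs_re_le_norm z)).trans hz1

end Spectrum

/-! ### Multiplication by `X₁` as an orthogonal projection -/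

namespace StationaryField

section Crystal

variable {Ω : Type*} [MeasurableSpace Ω] (P : Measure Ω) [IsProbabilityMeasure P]

theorem coeFn_mulOperator (m : Lp ℂ ∞ P) (f : ScalarL2 P) :
    mulOperator P m f =ᵐ[P] fun ω => m ω * f ω :=
  (ContinuousLinearMap.mul ℂ ℂ).coeFn_holder m f

variable (R : Ω → Matrix.specialOrthogonalGroup (Fin 3) ℝ)
  (hR : ∀ j k, Measurable fun ω => (R ω : Matrix (Fin 3) (Fin 3) ℝ) j k)

/-- Multiplication of scalar fields by an entry of `X₁`. -/
def entryOperator (j k : Fin 3) : ScalarL2 P →L[ℂ] ScalarL2 P :=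
  mulOperator P (crystalProjection_memLp P R hR j k).toLp

theorem coeFn_entryOperator (j k : Fin 3) (f : ScalarL2 P) :
    entryOperator P R hR j k f =ᵐ[P] fun ω =>
      ((crystalProjection (R ω : Matrix (Fin 3) (Fin 3) ℝ) j k : ℝ) : ℂ) * f ω := by
  filter_upwards [coeFn_mulOperator P (crystalProjection_memLp P R hR j k).toLp f,
    (crystalProjection_memLp P R hR j k).coeFn_toLp] with ω h1 h2
  rw [entryOperator, h1, h2]

theorem crystalProjection_transpose (A : Matrix (Fin 3) (Fin 3) ℝ) :
    (crystalProjection A).transpose = crystalProjection A := by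
  simp [crystalProjection, Matrix.transpose_mul, Matrix.mul_assoc]

theorem crystalProjection_mul_self (A : Matrix.specialOrthogonalGroup (Fin 3) ℝ) :
    crystalProjection (A : Matrix (Fin 3) (Fin 3) ℝ) * crystalProjection A =
      crystalProjection A := by
  have h : (A : Matrix (Fin 3) (Fin 3) ℝ) * (A : Matrix (Fin 3) (Fin 3) ℝ).transpose = 1 :=
    (Matrix.mem_orthogonalGroup_iff (Fin 3) ℝ).1 (Matrix.mem_specialOrthogonalGroup_iff.1 A.2).1
  have hd : Matrix.diagonal (Pi.single (0 : Fin 3) (1 : ℝ)) *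
      Matrix.diagonal (Pi.single (0 : Fin 3) (1 : ℝ)) = Matrix.diagonal (Pi.single 0 1) := by
    rw [Matrix.diagonal_mul_diagonal]
    congr 1
    funext i
    fin_cases i <;> simp
  simp only [crystalProjection]
  calc _ = (A : Matrix (Fin 3) (Fin 3) ℝ).transpose * (Matrix.diagonal (Pi.single 0 1) *
        ((A : Matrix (Fin 3) (Fin 3) ℝ) * (A : Matrix (Fin 3) (Fin 3) ℝ).transpose) *
        Matrix.diagonal (Pi.single 0 1)) * (A : Matrix (Fin 3) (Fin 3) ℝ) := by simp only [Matrix.mul_assoc]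
    _ = _ := by rw [h, Matrix.mul_one, hd]

theorem inner_entryOperator (j k : Fin 3) (f g : ScalarL2 P) :
    ⟪entryOperator P R hR j k f, g⟫_ℂ = ⟪f, entryOperator P R hR k j g⟫_ℂ := by
  rw [L2.inner_def, L2.inner_def]
  refine integral_congr_ae ?_
  filter_upwards [coeFn_entryOperator P R hR j k f, coeFn_entryOperator P R hR k j g] with ω h1 h2
  have h3 : crystalProjection (R ω : Matrix (Fin 3) (Fin 3) ℝ) j k =
      crystalProjection (R ω : Matrix (Fin 3) (Fin 3) ℝ) k j := by
    conv_lhs => rw [← crystalProjection_transpose, Matrix.transpose_apply]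
  rw [h1, h2, h3]
  simp only [RCLike.inner_apply, map_mul, Complex.conj_ofReal]
  ring

theorem sum_entryOperator (j l : Fin 3) (f : ScalarL2 P) :
    ∑ k, entryOperator P R hR j k (entryOperator P R hR k l f) = entryOperator P R hR j l f := by
  refine Lp.ext ?_
  rw [Fin.sum_univ_three]
  filter_upwards [Lp.coeFn_add (entryOperator P R hR j 0 (entryOperator P R hR 0 l f) +
      entryOperator P R hR j 1 (entryOperator P R hR 1 l f))
      (entryOperator P R hR j 2 (entryOperator P R hR 2 l f)),
    Lp.coeFn_add (entryOperator P R hR j 0 (entryOperator P R hR 0 l f))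
      (entryOperator P R hR j 1 (entryOperator P R hR 1 l f)),
    coeFn_entryOperator P R hR j 0 (entryOperator P R hR 0 l f),
    coeFn_entryOperator P R hR j 1 (entryOperator P R hR 1 l f),
    coeFn_entryOperator P R hR j 2 (entryOperator P R hR 2 l f),
    coeFn_entryOperator P R hR 0 l f, coeFn_entryOperator P R hR 1 l f,
    coeFn_entryOperator P R hR 2 l f, coeFn_entryOperator P R hR j l f]
    with ω a b c0 c1 c2 d0 d1 d2 h
  have hm := congrFun (congrFun (crystalProjection_mul_self (R ω)) j) l
  rw [Matrix.mul_apply, Fin.sum_univ_three] at hm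
  rw [a, Pi.add_apply, b, Pi.add_apply, c0, c1, c2, d0, d1, d2, h, ← hm]
  push_cast
  ring

theorem crystalOperator_apply (ξ : VectorL2 P) (j : Fin 3) :
    crystalOperator P R hR ξ j = ∑ k, entryOperator P R hR j k (ξ k) := by
  change (∑ k, mulOperator P (crystalProjection_memLp P R hR j k).toLp ∘L
        PiLp.proj 2 (fun _ : Fin 3 => ScalarL2 P) k) ξ = _
  rw [_root_.sum_apply]
  rfl

/-- At each `ω` the matrix `X₁` is real, symmetric and idempotent (`R Rᵀ = 1` and `C² = C`); the
operator inherits this entry by entry. -/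
theorem isStarProjection_crystalOperator : IsStarProjection (crystalOperator P R hR) where
  isIdempotentElem := by
    ext1 ξ
    refine PiLp.ext fun j => ?_
    rw [mul_apply_eq_comp, crystalOperator_apply]
    simp only [crystalOperator_apply, map_sum]
    rw [Finset.sum_comm]
    exact Finset.sum_congr rfl fun l _ => sum_entryOperator P R hR j l _
  isSelfAdjoint := by
    rw [ContinuousLinearMap.isSelfAdjoint_iff_isSymmetric]
    intro ξ ζ
    simp only [ContinuousLinearMap.coe_coe, PiLp.inner_apply, crystalOperator_apply, sum_inner,
      inner_sum]
    rw [Finset.sum_comm]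
    exact Finset.sum_congr rfl fun k _ => Finset.sum_congr rfl fun j _ =>
      inner_entryOperator P R hR j k _ _

end Crystal

end StationaryField

/-- A self-adjoint projection restricts to a self-adjoint projection on an invariant subspace. -/
theorem IsStarProjection.restrict {E : Type*} [NormedAddCommGroup E] [InnerProductSpace ℂ E]
    [CompleteSpace E] {T : E →L[ℂ] E} (hT : IsStarProjection T) {S : Submodule ℂ E}
    [CompleteSpace S] {A : S →L[ℂ] S} (hA : ∀ x : S, (A x : E) = T x) : IsStarProjection A where
  isIdempotentElem := by
    ext x
    have h := congrArg (fun B : E →L[ℂ] E => B x) hT.isIdempotentElem.eq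
    rw [mul_apply_eq_comp, hA, hA]
    exact h
  isSelfAdjoint := by
    rw [ContinuousLinearMap.isSelfAdjoint_iff_isSymmetric]
    intro x y
    have h := (ContinuousLinearMap.isSelfAdjoint_iff_isSymmetric.1 hT.isSelfAdjoint) (x : E) y
    simp only [ContinuousLinearMap.coe_coe, Submodule.coe_inner, hA] at h ⊢
    exact h

end

/-! ### Assembly of the five statements -/

theorem mainTheorem5 {Ω : Type*} [MeasurableSpace Ω] (P : Measure Ω) [IsProbabilityMeasure P]
    [AddAction (Fin 3 → ℝ) Ω] [MeasurableConstVAdd (Fin 3 → ℝ) Ω]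
    [ErgodicVAdd (Fin 3 → ℝ) Ω P]
    -- the translation operators form a strongly continuous group
    (hT : ∀ f : StationaryField.ScalarL2 P,
      Continuous fun x : Fin 3 → ℝ => StationaryField.translation P x f)
    -- the crystal orientation
    (R : Ω → Matrix.specialOrthogonalGroup (Fin 3) ℝ)
    (hR : ∀ j k, Measurable fun ω => (R ω : Matrix (Fin 3) (Fin 3) ℝ) j k) :
    -- in the completed space `H¹` the adjoint of the curl is the (closed) curl
    (∀ ζ ∈ StationaryField.H1Hilbert P, ∀ η ∈ StationaryField.H1Hilbert P,
      (∀ ξ : (StationaryField.curl P).domain,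
          ⟪StationaryField.curl P ξ, ζ⟫_ℂ = ⟪(ξ : StationaryField.VectorL2 P), η⟫_ℂ) ↔
        (ζ, η) ∈ (StationaryField.curl P).graph.topologicalClosure) ∧
    -- `∇×∇×` is one-to-one on the fields of `H²` in the kernel of `∇*`
    (StationaryField.curlCurl P).domain =
      StationaryField.H2 P ⊓ StationaryField.gradAdjointKernel P ∧
    LinearMap.ker (StationaryField.curlCurl P).toFun = ⊥ ∧
    -- the composite `∇×(∇×∇×)⁻¹∇×` is densely defined in `H¹`, it is defined on all of `H¹` if
    -- the range of the curl is closed, and its range consists of the curls that belong to `H¹`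
    (StationaryField.upsilonComposite P).domain ≤ StationaryField.H1 P ∧
    (StationaryField.upsilonComposite P).domain.topologicalClosure =
      StationaryField.H1Hilbert P ∧
    (IsClosed (StationaryField.curlRange P : Set (StationaryField.VectorL2 P)) →
      (StationaryField.upsilonComposite P).domain = StationaryField.H1 P) ∧
    LinearMap.range (StationaryField.upsilonComposite P).toFun =
      StationaryField.curlRange P ⊓ StationaryField.H1 P ∧
    -- `Υ` is its bounded extension to the completed space `H¹`
    ∃ Υ : StationaryField.H1Hilbert P →L[ℂ] StationaryField.H1Hilbert P,
      (∀ (ξ : (StationaryField.upsilonComposite P).domain)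
          (hξ : (ξ : StationaryField.VectorL2 P) ∈ StationaryField.H1Hilbert P),
        (Υ ⟨ξ, hξ⟩ : StationaryField.VectorL2 P) = StationaryField.upsilonComposite P ξ) ∧
      -- `Υ` is the orthogonal projection onto the (closed) range of the curl, it maps `H¹` into
      -- `H¹`, and it is self-adjoint
      (∀ ξ : StationaryField.H1Hilbert P, (Υ ξ : StationaryField.VectorL2 P) =
        (StationaryField.curlRange P).topologicalClosure.starProjection
          (ξ : StationaryField.VectorL2 P)) ∧
      (∀ ξ : StationaryField.H1Hilbert P,
        (ξ : StationaryField.VectorL2 P) ∈ StationaryField.H1 P →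
          (Υ ξ : StationaryField.VectorL2 P) ∈ StationaryField.H1 P) ∧
      IsSelfAdjoint Υ ∧
      -- `X₁ΥX₁` on the completed space `H¹`, for `X₁` that maps `H¹` into `H¹`
      ((∀ ξ ∈ StationaryField.H1 P,
          StationaryField.crystalOperator P R hR ξ ∈ StationaryField.H1 P) →
        ∃ X : StationaryField.H1Hilbert P →L[ℂ] StationaryField.H1Hilbert P,
          (∀ ξ : StationaryField.H1Hilbert P, (X ξ : StationaryField.VectorL2 P) =
            StationaryField.crystalOperator P R hR (ξ : StationaryField.VectorL2 P)) ∧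
          (∀ ξ : StationaryField.H1Hilbert P,
            (ξ : StationaryField.VectorL2 P) ∈ StationaryField.H1 P →
              ((X ∘L Υ ∘L X) ξ : StationaryField.VectorL2 P) ∈ StationaryField.H1 P) ∧
          IsSelfAdjoint (X ∘L Υ ∘L X) ∧
          spectrum ℂ (X ∘L Υ ∘L X) ⊆ Complex.ofReal '' Set.Icc 0 1) ∧
      -- `X₁ΥX₁` on all square-integrable fields, where `Υ` vanishes on the constant fields
      IsSelfAdjoint (StationaryField.crystalOperator P R hR ∘L
        StationaryField.extendByZero P Υ ∘L StationaryField.crystalOperator P R hR) ∧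
      spectrum ℂ (StationaryField.crystalOperator P R hR ∘L
        StationaryField.extendByZero P Υ ∘L StationaryField.crystalOperator P R hR) ⊆
          Complex.ofReal '' Set.Icc 0 1 := by
  have hsa := isStarProjection_starProjection
    (U := (StationaryField.curlRange P).topologicalClosure)
  have hle := StationaryField.closure_curlRange_le P hT
  have hU := StationaryField.isErgodicFlow_flow P hT
  have hX := StationaryField.isStarProjection_crystalOperator P R hR
  set K := (StationaryField.curlRange P).topologicalClosure with hK
  let Υ : StationaryField.H1Hilbert P →L[ℂ] StationaryField.H1Hilbert P :=
    (K.starProjection ∘L (StationaryField.H1Hilbert P).subtypeL).codRestrict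
      (StationaryField.H1Hilbert P) fun ξ => hle (Submodule.starProjection_apply_mem K _)
  have hΥ : ∀ ξ, (Υ ξ : StationaryField.VectorL2 P) = K.starProjection ξ := fun _ => rfl
  have hΥp : IsStarProjection Υ := hsa.restrict hΥ
  have hΥ1 : ∀ ξ : StationaryField.H1Hilbert P,
      (ξ : StationaryField.VectorL2 P) ∈ StationaryField.H1 P →
        (Υ ξ : StationaryField.VectorL2 P) ∈ StationaryField.H1 P := fun ξ hξ =>
    (StationaryField.mem_H1 P).2 (((StationaryField.mem_H1 P).1 hξ).starProjection hU
      fun _ => StationaryField.mem_curlRange P)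
  -- The extension by zero is the projection onto `K` after the projection onto `H1Hilbert P`; these
  -- compose to the former because `K` is the smaller space.
  have hext : StationaryField.extendByZero P Υ = K.starProjection := by
    ext1 ξ
    exact congrArg (fun A : StationaryField.VectorL2 P →L[ℂ] StationaryField.VectorL2 P => A ξ)
      (Submodule.starProjection_comp_starProjection_of_le hle)
  refine ⟨fun ζ hζ η hη => StationaryField.curl_adjoint_iff P hT hζ hη,
    StationaryField.curlCurl_domain P hT, StationaryField.ker_curlCurl P hT,
    StationaryField.upsilonComposite_domain_le P hT,
    StationaryField.closure_upsilonComposite_domain P hT,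
    StationaryField.upsilonComposite_domain_eq P hT, StationaryField.range_upsilonComposite P hT,
    Υ, fun ξ hξ => ?_, hΥ, hΥ1, hΥp.isSelfAdjoint, fun h1 => ?_, ?_, ?_⟩
  · exact StationaryField.upsilonComposite_eq_starProjection P hT
      ((StationaryField.upsilonComposite P).mem_graph ξ)
  -- Continuity of `X₁` carries the invariance of `H1` over to its closure.
  · have hmem : ∀ ξ : StationaryField.H1Hilbert P, StationaryField.crystalOperator P R hR ξ ∈
        StationaryField.H1Hilbert P := fun ξ =>
      map_mem_closure (StationaryField.crystalOperator P R hR).continuous ξ.2 h1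
    let X : StationaryField.H1Hilbert P →L[ℂ] StationaryField.H1Hilbert P :=
      (StationaryField.crystalOperator P R hR ∘L (StationaryField.H1Hilbert P).subtypeL).codRestrict
        (StationaryField.H1Hilbert P) hmem
    have hXa : ∀ ξ, (X ξ : StationaryField.VectorL2 P) =
      StationaryField.crystalOperator P R hR ξ := fun _ => rfl
    have hXp : IsStarProjection X := hX.restrict hXa
    exact ⟨X, hXa, fun ξ hξ => h1 _ (hΥ1 _ (h1 _ hξ)),
      isSelfAdjoint_comp_comp hXp.isSelfAdjoint hΥp.isSelfAdjoint,
      spectrum_comp_comp_subset hXp hΥp⟩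
  · rw [hext]
    exact isSelfAdjoint_comp_comp hX.isSelfAdjoint hsa.isSelfAdjoint
  · rw [hext]
    exact spectrum_comp_comp_subset hX hsa
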